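/- Let $(a,b)\in\mathcal M=\{(a,b)\in\mathbb R^2 : b>0,\ a\sqrt2-b>2,\ 2a+b<4\}$ and let $L=L_{a,b}:\mathbb R^2\to\mathbb R^2$, $L(x,y)=(1+y-a|x|,\,bx)$, be the Lozi map. Let $X=\left(\frac{1}{1+a-b},\frac{b}{1+a-b}\right)$ be its fixed point in the first quadrant, let $W^s_X=\{P : L^n(P)\to X\}$ be the stable manifold of $X$, let $Z=\left(\frac{2+a+\sqrt{a^2+4b}}{2(1+a-b)},0\right)$, let $\Delta$ be the (filled) triangle with vertices $Z$, $L(Z)$, $L^2(Z)$, and let $\Lambda=\bigcap_{n\ge0}L^n(\Delta)$ be the strange attractor. Let $\Gamma$ be the family of connected components of $\Delta\cap W^s_X$. Then $L(\Delta)\subset\Delta$ and $L(\Lambda)\subset\Lambda$, and there exist a metric tree (dendrite) $\mathbb T$, that is, a compact, connected, locally connected metric space with at least two points in which any two distinct points are the endpoints of a unique arc, and a continuous map $f:\mathbb T\to\mathbb T$, such that: (i) $\mathbb T$ and $f$ are obtained from $\Delta$, $L$ and $\Gamma$ as follows: there is a continuous surjection $\pi:\Delta\to\mathbb T$ with $\pi\circ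 L|_\Delta=f\circ\pi$, and $\pi(p)=\pi(q)$ if and only if no $\gamma\in\Gamma$ separates $p$ and $q$ in $\Delta$ (that is, for no $\gamma\in\Gamma$ do $p,q$ lie in different connected components of $\Delta\setminus\gamma$); (ii) $L|_\Lambda$ is topologically conjugate to the shift homeomorphism $\sigma_f(x_0,x_1,x_2,\dots)=(f(x_0),x_0,x_1,\dots)$ on the inverse limit $\varprojlim(\mathbb T,f)=\{(x_0,x_1,\dots)\in\mathbb T^{\mathbb N_0} : f(x_{i+1})=x_i \text{ for all } i\ge0\}$ with the product topology: there is a homeomorphism $\Phi:\Lambda\to\varprojlim(\mathbb T,f)$ with $\Phi\circ L|_\Lambda=\sigma_f\circ\Phi$. -/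

import Mathlib

open Set Filter Topology

noncomputable section

/-- The Lozi map `L_{a,b}(x, y) = (1 + y - a|x|, b x)`. -/
def loziMap (a b : ℝ) (p : ℝ × ℝ) : ℝ × ℝ :=
  (1 + p.2 - a * |p.1|, b * p.1)

/-- The Misiurewicz parameter set. -/
def misiurewiczSet : Set (ℝ × ℝ) :=
  {q | 0 < q.2 ∧ 2 < q.1 * Real.sqrt 2 - q.2 ∧ 2 * q.1 + q.2 < 4}

/-- The fixed point `X` of the Lozi map in the first quadrant. -/
def loziX (a b : ℝ) : ℝ × ℝ :=
  (1 / (1 + a - b), b / (1 + a - b))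

/-- The first point in which the right half of the unstable manifold of `X` meets the
horizontal axis. -/
def loziZ (a b : ℝ) : ℝ × ℝ :=
  ((2 + a + Real.sqrt (a ^ 2 + 4 * b)) / (2 * (1 + a - b)), 0)

/-- The (closed, filled) triangle `Δ` with vertices `Z`, `L(Z)`, `L²(Z)`. -/
def loziTriangle (a b : ℝ) : Set (ℝ × ℝ) :=
  convexHull ℝ {loziZ a b, loziMap a b (loziZ a b), loziMap a b (loziMap a b (loziZ a b))}

/-- The strange attractor `Λ = ⋂ₙ Lⁿ(Δ)`. -/
def loziAttractor (a b : ℝ) : Set (ℝ × ℝ) :=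
  ⋂ n : ℕ, (loziMap a b)^[n] '' loziTriangle a b

/-- The stable manifold `W^s_X` of the fixed point `X`. -/
def loziStable (a b : ℝ) : Set (ℝ × ℝ) :=
  {p | Tendsto (fun n : ℕ => (loziMap a b)^[n] p) atTop (𝓝 (loziX a b))}

/-- The family `Γ` of connected components of `Δ ∩ W^s_X`. -/
def loziGamma (a b : ℝ) : Set (Set (ℝ × ℝ)) :=
  {γ | ∃ p ∈ loziTriangle a b ∩ loziStable a b,
    γ = connectedComponentIn (loziTriangle a b ∩ loziStable a b) p}

/-- `C` separates `p` from `q` in `D`: the points `p`, `q` lie in two different connected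
components of `D \ C`. -/
def SeparatesIn (D C : Set (ℝ × ℝ)) (p q : ℝ × ℝ) : Prop :=
  p ∈ D \ C ∧ q ∈ D \ C ∧ q ∉ connectedComponentIn (D \ C) p

/-- `A` is an arc with endpoints `x` and `y`. -/
def IsArcBetween {T : Type*} [TopologicalSpace T] (A : Set T) (x y : T) : Prop :=
  ∃ e : unitInterval → T, Continuous e ∧ Function.Injective e ∧
    e 0 = x ∧ e 1 = y ∧ Set.range e = A

/-- Metric trees (dendrites): compact, connected, locally connected metric spaces with at least
two points, in which any two distinct points are the endpoints of a unique arc. -/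
structure IsMetricTree (T : Type*) [MetricSpace T] : Prop where
  compact : CompactSpace T
  connected : ConnectedSpace T
  locallyConnected : LocallyConnectedSpace T
  nontrivial : Nontrivial T
  uniqueArc : ∀ x y : T, x ≠ y → ∃! A : Set T, IsArcBetween A x y

/-- The inverse limit of `T` with the single bonding map `f`, with the topology induced by the
product topology. -/
abbrev InverseLimit {T : Type*} (f : T → T) : Type _ :=
  {x : ℕ → T // ∀ i, f (x (i + 1)) = x i}

/-- The shift `σ_f (x₀, x₁, …) = (f x₀, f x₁, …) = (f x₀, x₀, x₁, …)` on the inverse limit; its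
inverse is `(x₀, x₁, x₂, …) ↦ (x₁, x₂, …)`. -/
def inverseLimitShift {T : Type*} (f : T → T) : InverseLimit f ≃ InverseLimit f where
  toFun x := ⟨fun i => f (x.1 i), fun i => congrArg f (x.2 i)⟩
  invFun x := ⟨fun i => x.1 (i + 1), fun i => x.2 (i + 1)⟩
  left_inv x := Subtype.ext (funext fun i => x.2 i)
  right_inv x := Subtype.ext (funext fun i => x.2 i)

/-- The shift on the inverse limit of a continuous map, as a homeomorphism. -/
def shiftHomeomorph {T : Type*} [TopologicalSpace T] (f : T → T) (hf : Continuous f) :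
    InverseLimit f ≃ₜ InverseLimit f where
  toEquiv := inverseLimitShift f
  continuous_toFun := by
    refine Continuous.subtype_mk (f := fun (x : InverseLimit f) (i : ℕ) => f (x.1 i)) ?_ _
    exact continuous_pi fun i => hf.comp ((continuous_apply i).comp continuous_subtype_val)
  continuous_invFun := by
    refine Continuous.subtype_mk (f := fun (x : InverseLimit f) (i : ℕ) => x.1 (i + 1)) ?_ _
    exact continuous_pi fun i => (continuous_apply (i + 1)).comp continuous_subtype_val

end

/-!
The quotient of the triangle `Δ` by the relation of not being separated by any `γ ∈ Γ` is a dendrite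
and carries the dynamics of `L` on `Λ` because the classes are continua which `L` contracts
uniformly.

*Contraction* (`LoziParams.dist_iterate_le_of_oneSided`). Let `ℓ = 0` be the line through `X` in the
stable direction; `loziLine` is `ℓ`. In `Δ`, points with `x ≤ 0` satisfy `ℓ < 0`, and points with
`x = 0` are mapped to `ℓ > 0`. Hence if no image of a connected set `K ⊆ Δ` has points strictly on
both sides of `ℓ = 0`, an image of `K` that meets the fold `x = 0` is mapped into `x > 0`. The
widths `wᵢ` of the images then satisfy `w_{i+1} ≥ a w_i - b w_{i-1}` away from the fold and
`w_{i+2} ≥ (a²/2 - 2b²/a²) w_i - b² w_{i-2}` at the fold. In the Misiurewicz set these inequalities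
make the bounded sequence `wᵢ` decay geometrically, since it would otherwise grow without bound.

*Leaves.* The trace `Δ ∩ W^s_X` is the disjoint union of the closed sets `stablePiece` of points
that reach the line `ℓ = 0` after exactly `n` steps. The components of these pieces (`stableLeaves`)
are disjoint continua. As `Δ` is unicoherent (`unicoherent_of_simplyConnected`), a closed set that
separates two points contains a continuum that does (`Separates.exists_isPreconnected`). This shows
that points not separated by a leaf have images not separated by a leaf, and are never strictly on
different sides of `ℓ = 0`. It also shows that the classes are connected, being intersections of
continua which are pairwise nested or cover `Δ`
(`DisjointContinua.isPreconnected_setOf_notSeparated`). By contraction, a class that meets `W^s_X`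
is contained in it, so by Sierpiński's theorem it is a single leaf. Therefore the relation is an
equivalence, the leaves are classes, and they separate any two other classes.

*The tree* (`DisjointContinua.exists_isMetricTree`). It follows that the quotient is a Hausdorff,
hence metrizable, path connected and locally connected continuum in which any two points are
separated by a third one. Such a space is a dendrite (`isMetricTree_of_separates`): a path can be
reduced to an arc, and two different arcs with common ends would leave a pair of points that no
point separates. In the quotient the
image of `W^s_X` is countable, so the components of `Δ ∩ W^s_X` become points; that is, `Γ` is the
family of leaves (`LoziParams.loziGamma_eq`).

*The inverse limit* (`LoziParams.exists_homeomorph_inverseLimit`). A point of `Λ` is sent to the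
sequence of classes of its backward orbit. This is onto by compactness, and one-to-one since two
points whose `n`-th preimages lie in one class for all `n` are at distance at most `C (9/10)ⁿ` for
all `n`.
-/

/-! ### Unicoherence and separation in locally connected continua -/

/-- A space is unicoherent if any two closed connected sets that cover it meet in a connected
set. -/
def Unicoherent (X : Type*) [TopologicalSpace X] : Prop :=
  ∀ A B : Set X, IsClosed A → IsClosed B → IsPreconnected A → IsPreconnected B →
    A ∪ B = univ → IsPreconnected (A ∩ B)

/-- On a preconnected set, a continuous function with values in `2πℤ` is constant. -/
theorem IsPreconnected.eq_of_forall_two_pi_int {X : Type*} [TopologicalSpace X] {A : Set X}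
    (hA : IsPreconnected A) {g : X → ℝ} (hg : ContinuousOn g A)
    (h : ∀ x ∈ A, ∃ n : ℤ, g x = n * (2 * Real.pi)) {x y : X} (hx : x ∈ A) (hy : y ∈ A) :
    g x = g y := by
  have hc : IsPreconnected (g '' A) := hA.image g hg
  have hcount : (g '' A).Countable := by
    refine (countable_range fun n : ℤ => (n : ℝ) * (2 * Real.pi)).mono ?_
    rintro _ ⟨x, hx, rfl⟩
    obtain ⟨n, hn⟩ := h x hx
    exact ⟨n, hn.symm⟩
  exact hcount.isTotallyDisconnected _ subset_rfl hc (mem_image_of_mem g hx) (mem_image_of_mem g hy)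

/-- A simply connected, locally path connected normal space is unicoherent. If `A ∩ B` were the
disjoint union of closed sets `P` and `Q`, choose `h` with `h = 0` on `P` and `h = 1` on `Q`; the
circle-valued map equal to `exp (iπh)` on `A` and `exp (-iπh)` on `B` has a real logarithm `g`,
and `g - πh`, `g + πh` are constant on `A`, `B` respectively, which is absurd. -/
theorem unicoherent_of_simplyConnected (X : Type*) [TopologicalSpace X] [NormalSpace X]
    [SimplyConnectedSpace X] [LocallyPathConnectedSpace X] : Unicoherent X := by
  intro A B hA hB hAc hBc hAB
  by_contra hcon
  rw [isPreconnected_closed_iff] at hcon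
  push Not at hcon
  obtain ⟨t, t', ht, ht', hsub, hne, hne', hempty⟩ := hcon
  obtain ⟨h, h0, h1, -⟩ := exists_continuous_zero_one_of_isClosed
    (s := A ∩ B ∩ t) (t := A ∩ B ∩ t') ((hA.inter hB).inter ht) ((hA.inter hB).inter ht') (by
      rw [Set.disjoint_left]
      rintro x ⟨hx, hxt⟩ ⟨-, hxt'⟩
      exact (hempty.subset ⟨hx, hxt, hxt'⟩).elim)
  classical
  let φ : X → Circle := fun x =>
    if x ∈ A then Circle.exp (Real.pi * h x) else Circle.exp (-(Real.pi * h x))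
  have hexp : Circle.exp (Real.pi * 1) = Circle.exp (-(Real.pi * 1)) := by
    rw [mul_one]
    have := Circle.exp_sub_two_pi Real.pi
    rw [← this]
    congr 1
    ring
  have hφB : ∀ x ∈ B, φ x = Circle.exp (-(Real.pi * h x)) := by
    intro x hx
    by_cases hxA : x ∈ A
    · simp only [φ, hxA, if_true]
      rcases hsub ⟨hxA, hx⟩ with hxt | hxt
      · rw [h0 ⟨⟨hxA, hx⟩, hxt⟩]; simp
      · rw [h1 ⟨⟨hxA, hx⟩, hxt⟩]; exact hexp
    · simp only [φ, hxA, if_false]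
  have hφA : ∀ x ∈ A, φ x = Circle.exp (Real.pi * h x) := by
    intro x hx; simp only [φ, hx, if_true]
  have hφ : Continuous φ := by
    rw [← continuousOn_univ, ← hAB]
    refine ContinuousOn.union_of_isClosed ?_ ?_ hA hB
    · refine ContinuousOn.congr (f := fun x => Circle.exp (Real.pi * h x)) ?_ hφA
      exact (Circle.exp.continuous.comp (continuous_const.mul h.continuous)).continuousOn
    · refine ContinuousOn.congr (f := fun x => Circle.exp (-(Real.pi * h x))) ?_ hφB
      exact (Circle.exp.continuous.comp (continuous_const.mul h.continuous).neg).continuousOn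
  obtain ⟨p, hp⟩ := hne
  obtain ⟨q, hq⟩ := hne'
  have hpφ : Circle.exp 0 = φ p := by
    rw [hφA p hp.1.1, h0 hp]; simp
  obtain ⟨g, ⟨-, hg⟩, -⟩ := Circle.isCoveringMap_exp.existsUnique_continuousMap_lifts
    ⟨φ, hφ⟩ p 0 hpφ
  have hg' : ∀ x, Circle.exp (g x) = φ x := fun x => congrFun hg x
  have e1 := hAc.eq_of_forall_two_pi_int (g := fun x => g x - Real.pi * h x)
    (by fun_prop) (fun x hx => by
      have := (hg' x).trans (hφA x hx)
      obtain ⟨m, hm⟩ := Circle.exp_eq_exp.1 this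
      exact ⟨m, by simp only [hm]; ring⟩) hp.1.1 hq.1.1
  have e2 := hBc.eq_of_forall_two_pi_int (g := fun x => g x + Real.pi * h x)
    (by fun_prop) (fun x hx => by
      have := (hg' x).trans (hφB x hx)
      obtain ⟨m, hm⟩ := Circle.exp_eq_exp.1 this
      exact ⟨m, by simp only [hm]; ring⟩) hp.1.2 hq.1.2
  simp only [h0 hp, h1 hq, Pi.zero_apply, Pi.one_apply] at e1 e2
  linarith [Real.pi_pos]

section Separation

variable {X : Type*} [TopologicalSpace X]

/-- `C` separates `p` from `q`: they lie in two different components of the complement. -/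
def Separates (C : Set X) (p q : X) : Prop :=
  p ∉ C ∧ q ∉ C ∧ q ∉ connectedComponentIn Cᶜ p

theorem mem_connectedComponentIn_iff {F : Set X} {x y : X} :
    y ∈ connectedComponentIn F x ↔ ∃ s ⊆ F, IsPreconnected s ∧ x ∈ s ∧ y ∈ s := by
  constructor
  · intro h
    have hx : x ∈ F := by
      by_contra hx
      rw [connectedComponentIn_eq_empty hx] at h
      exact h
    exact ⟨_, connectedComponentIn_subset F x, isPreconnected_connectedComponentIn,
      mem_connectedComponentIn hx, h⟩
  · rintro ⟨s, hs, hc, hx, hy⟩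
    exact hc.subset_connectedComponentIn hx hs hy

theorem Separates.symm {C : Set X} {p q : X} (h : Separates C p q) : Separates C q p := by
  refine ⟨h.2.1, h.1, fun hp => h.2.2 ?_⟩
  rw [mem_connectedComponentIn_iff] at hp ⊢
  obtain ⟨s, h1, h2, h3, h4⟩ := hp
  exact ⟨s, h1, h2, h4, h3⟩

theorem not_separates_of_isPreconnected {C s : Set X} {p q : X} (hs : IsPreconnected s)
    (hsC : Disjoint s C) (hp : p ∈ s) (hq : q ∈ s) : ¬ Separates C p q := fun h =>
  h.2.2 (mem_connectedComponentIn_iff.2 ⟨s, disjoint_left.1 hsC, hs, hp, hq⟩)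

theorem Separates.mono {C C' : Set X} {p q : X} (h : Separates C p q) (hC : C ⊆ C')
    (hp : p ∉ C') (hq : q ∉ C') : Separates C' p q :=
  ⟨hp, hq, fun hc => h.2.2 (connectedComponentIn_mono p (compl_subset_compl.2 hC) hc)⟩

/-- Two points on the two sides of a partition of the complement into open sets are separated. -/
theorem separates_of_isOpen {C U V : Set X} {p q : X} (hU : IsOpen U) (hV : IsOpen V)
    (hUV : Disjoint U V) (hC : Cᶜ ⊆ U ∪ V) (hp : p ∈ U) (hpC : p ∉ C) (hq : q ∈ V)
    (hqC : q ∉ C) : Separates C p q := by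
  refine ⟨hpC, hqC, fun h => ?_⟩
  obtain ⟨s, hs, hc, hps, hqs⟩ := mem_connectedComponentIn_iff.1 h
  obtain ⟨x, -, hxU, hxV⟩ := hc U V hU hV (hs.trans hC) ⟨p, hps, hp⟩ ⟨q, hqs, hq⟩
  exact disjoint_left.1 hUV hxU hxV

theorem closure_connectedComponentIn_subset {C : Set X} {x : X} :
    closure (connectedComponentIn Cᶜ x) ⊆ connectedComponentIn Cᶜ x ∪ C := by
  intro y hy
  by_cases hyC : y ∈ C
  · exact Or.inr hyC
  left
  by_cases hx : x ∈ Cᶜ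
  · have h1 : IsPreconnected (insert y (connectedComponentIn Cᶜ x)) :=
      isPreconnected_connectedComponentIn.subset_closure (subset_insert _ _)
        (insert_subset hy subset_closure)
    exact h1.subset_connectedComponentIn (mem_insert_of_mem _ (mem_connectedComponentIn hx))
      (insert_subset hyC (connectedComponentIn_subset _ _)) (mem_insert _ _)
  · rw [connectedComponentIn_eq_empty hx] at hy
    simp at hy

variable [ConnectedSpace X] [LocallyConnectedSpace X]

/-- In a connected space, a component of the complement of a nonempty closed set accumulates on
that set. -/
theorem isPreconnected_union_connectedComponentIn {C : Set X} (hC : IsClosed C)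
    (hCc : IsPreconnected C) (hne : C.Nonempty) (x : X) :
    IsPreconnected (C ∪ connectedComponentIn Cᶜ x) := by
  set U := connectedComponentIn Cᶜ x with hU
  by_cases hUe : U = ∅
  · rw [hUe, union_empty]; exact hCc
  have hUo : IsOpen U := hC.isOpen_compl.connectedComponentIn
  have hmeet : (C ∩ closure U).Nonempty := by
    by_contra hem
    rw [not_nonempty_iff_eq_empty] at hem
    have hcl : IsClosed U := by
      refine closure_subset_iff_isClosed.1 fun y hy => ?_
      rcases closure_connectedComponentIn_subset hy with h | h
      · exact h
      · exact (hem.subset ⟨h, hy⟩).elim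
    have huniv : U = univ :=
      IsClopen.eq_univ ⟨hcl, hUo⟩ (nonempty_iff_ne_empty.2 hUe)
    obtain ⟨c, hc⟩ := hne
    have : c ∈ U := huniv ▸ mem_univ c
    exact connectedComponentIn_subset _ _ this hc
  have h2 : C ∪ U = C ∪ closure U := by
    apply Subset.antisymm
    · exact union_subset_union_right _ subset_closure
    · refine union_subset subset_union_left ?_
      exact closure_connectedComponentIn_subset.trans (union_comm _ _).subset
  rw [h2]
  exact IsPreconnected.union' hmeet hCc isPreconnected_connectedComponentIn.closure

/-- The complement of a component of the complement of a continuum is connected. -/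
theorem isPreconnected_compl_connectedComponentIn {C : Set X} (hC : IsClosed C)
    (hCc : IsPreconnected C) (hne : C.Nonempty) (x : X) :
    IsPreconnected (connectedComponentIn Cᶜ x)ᶜ := by
  obtain ⟨c, hc⟩ := hne
  refine isPreconnected_of_forall c fun y hy => ?_
  refine ⟨C ∪ connectedComponentIn Cᶜ y, ?_, Or.inl hc, ?_,
    isPreconnected_union_connectedComponentIn hC hCc ⟨c, hc⟩ y⟩
  · rintro z (hz | hz) hzx
    · exact connectedComponentIn_subset _ _ hzx hz
    · refine hy ?_
      rw [connectedComponentIn_eq hzx, ← connectedComponentIn_eq hz]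
      refine mem_connectedComponentIn fun hyC => ?_
      rw [connectedComponentIn_eq_empty (not_not.2 hyC)] at hz
      exact hz
  · by_cases hyC : y ∈ C
    · exact Or.inl hyC
    · exact Or.inr (mem_connectedComponentIn hyC)

/-- In a unicoherent locally connected continuum, a closed set that separates two points contains
a continuum that separates them, namely the boundary of a suitable complementary domain. -/
theorem Separates.exists_isPreconnected (hX : Unicoherent X) {S : Set X} (hS : IsClosed S)
    {p q : X} (h : Separates S p q) :
    ∃ M ⊆ S, IsClosed M ∧ IsPreconnected M ∧ M.Nonempty ∧ Separates M p q := by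
  set U := connectedComponentIn Sᶜ p with hU
  have hpU : p ∈ U := mem_connectedComponentIn h.1
  have hUo : IsOpen U := hS.isOpen_compl.connectedComponentIn
  have hqU : q ∉ closure U := fun hq =>
    (closure_connectedComponentIn_subset hq).elim h.2.2 h.2.1
  set V := connectedComponentIn (closure U)ᶜ q with hV
  have hqV : q ∈ V := mem_connectedComponentIn hqU
  have hVo : IsOpen V := isClosed_closure.isOpen_compl.connectedComponentIn
  have hUV : Disjoint (closure V) U := by
    refine Disjoint.closure_left ?_ hUo
    exact disjoint_left.2 fun x hxV hxU =>
      connectedComponentIn_subset _ _ hxV (subset_closure hxU)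
  have hVc : IsPreconnected Vᶜ := isPreconnected_compl_connectedComponentIn isClosed_closure
    isPreconnected_connectedComponentIn.closure ⟨p, subset_closure hpU⟩ q
  have hpV : p ∉ closure V := fun hp => disjoint_left.1 hUV hp hpU
  have hMS : closure V ∩ Vᶜ ⊆ S := by
    rintro x ⟨hx, hxV⟩
    rcases closure_connectedComponentIn_subset hx with h1 | h1
    · exact (hxV h1).elim
    · rcases closure_connectedComponentIn_subset h1 with h2 | h2
      · exact (disjoint_left.1 hUV hx h2).elim
      · exact h2
  refine ⟨closure V ∩ Vᶜ, hMS, isClosed_closure.inter hVo.isClosed_compl,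
    hX _ _ isClosed_closure hVo.isClosed_compl isPreconnected_connectedComponentIn.closure hVc
      ?_, ?_, ?_⟩
  · rw [eq_univ_iff_forall]
    intro x
    by_cases hx : x ∈ V
    · exact Or.inl (subset_closure hx)
    · exact Or.inr hx
  · by_contra hem
    rw [not_nonempty_iff_eq_empty] at hem
    have hcl : IsClosed V := by
      refine closure_subset_iff_isClosed.1 fun y hy => ?_
      by_contra hyV
      exact hem.subset ⟨hy, hyV⟩
    have huniv : V = univ := IsClopen.eq_univ ⟨hcl, hVo⟩ ⟨q, hqV⟩
    exact hpV (subset_closure (huniv ▸ mem_univ p))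
  · refine separates_of_isOpen (U := (closure V)ᶜ) (V := V) isClosed_closure.isOpen_compl hVo
      (disjoint_left.2 fun x hx hxV => hx (subset_closure hxV)) ?_ hpV (fun hp => hpV hp.1) hqV
      (fun hq => hq.2 hqV)
    intro x hx
    by_cases hxV : x ∈ V
    · exact Or.inr hxV
    · exact Or.inl fun hxc => hx ⟨hxc, hxV⟩

end Separation

/-! ### Countable partitions and intersections of continua -/

/-- Boundary bumping: a component of the trace of a compact connected set on the closure of an
open set leaves that open set. -/
theorem exists_mem_connectedComponentIn_notMem {X : Type*} [TopologicalSpace X]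
    [T2Space X] {K U : Set X} (hK : IsCompact K) (hKc : IsPreconnected K) (hU : IsOpen U)
    {x : X} (hx : x ∈ K ∩ U) (hKU : ¬ K ⊆ U) :
    ∃ y ∈ connectedComponentIn (K ∩ closure U) x, y ∉ U := by
  by_contra! hcon
  set Y := K ∩ closure U with hY
  have hxY : x ∈ Y := ⟨hx.1, subset_closure hx.2⟩
  have hYc : IsCompact Y := hK.inter_right isClosed_closure
  have : CompactSpace Y := isCompact_iff_compactSpace.1 hYc
  have hsub : (⋂ s : { s : Set Y // IsClopen s ∧ (⟨x, hxY⟩ : Y) ∈ s }, (s : Set Y)) ⊆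
      Subtype.val ⁻¹' U := by
    rw [← connectedComponent_eq_iInter_isClopen]
    intro y hy
    apply hcon
    rw [connectedComponentIn_eq_image hxY]
    exact mem_image_of_mem _ hy
  have : Nonempty { s : Set Y // IsClopen s ∧ (⟨x, hxY⟩ : Y) ∈ s } :=
    ⟨⟨univ, isClopen_univ, mem_univ _⟩⟩
  obtain ⟨⟨Z, hZ, hxZ⟩, hZU⟩ := exists_subset_nhds_of_compactSpace
    (V := fun s : { s : Set Y // IsClopen s ∧ (⟨x, hxY⟩ : Y) ∈ s } => (s : Set Y)) (by
      rintro ⟨s, hs, hxs⟩ ⟨t, ht, hxt⟩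
      exact ⟨⟨s ∩ t, hs.inter ht, hxs, hxt⟩, inter_subset_left, inter_subset_right⟩)
    (fun s => s.2.1.isClosed) (U := Subtype.val ⁻¹' U)
    (fun y hy => (hU.preimage continuous_subtype_val).mem_nhds (hsub hy))
  obtain ⟨O, hO, rfl⟩ := isOpen_induced_iff.1 hZ.isOpen
  -- `Z` is relatively clopen in `K`, so it is all of `K`
  have hZcl : IsClosed (Subtype.val '' (Subtype.val ⁻¹' O : Set Y)) :=
    (hYc.isClosed.isClosedEmbedding_subtypeVal.isClosedMap _ hZ.isClosed)
  refine hKU fun z hz => ?_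
  by_contra hzU
  obtain ⟨w, hwK, hw1, hw2⟩ := hKc (O ∩ U) (Subtype.val '' (Subtype.val ⁻¹' O : Set Y))ᶜ
    (hO.inter hU) hZcl.isOpen_compl (by
      intro w hw
      by_cases h : w ∈ Subtype.val '' (Subtype.val ⁻¹' O : Set Y)
      · obtain ⟨v, hv, rfl⟩ := h
        exact Or.inl ⟨hv, hZU hv⟩
      · exact Or.inr h) ⟨x, hx.1, hxZ, hx.2⟩ ⟨z, hz, by
        rintro ⟨v, hv, rfl⟩
        exact hzU (hZU hv)⟩
  exact hw2 ⟨⟨w, hwK, subset_closure hw1.2⟩, hw1.1, rfl⟩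

/-- Sierpiński's theorem: a continuum is not a disjoint union of countably many closed sets, at
least two of which are nonempty. -/
theorem exists_subset_of_isPreconnected_of_subset_iUnion {X : Type*} [TopologicalSpace X]
    [T2Space X] [NormalSpace X] {D : ℕ → Set X} (hD : ∀ n, IsClosed (D n))
    (hdisj : ∀ m n, m ≠ n → Disjoint (D m) (D n)) {K : Set X} (hK : IsCompact K)
    (hKc : IsPreconnected K) (hKD : K ⊆ ⋃ n, D n) : ∃ n, K ⊆ D n := by
  by_contra! hcon
  let S : Set (Set X) := {L | IsCompact L ∧ IsPreconnected L ∧ L ⊆ K ∧ ∀ n, ¬ L ⊆ D n}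
  have step : ∀ L ∈ S, ∀ m, ∃ L' ∈ S, L' ⊆ L ∧ L' ∩ D m = ∅ := by
    rintro L ⟨hL, hLc, hLK, hLn⟩ m
    by_cases hm : L ∩ D m = ∅
    · exact ⟨L, ⟨hL, hLc, hLK, hLn⟩, subset_rfl, hm⟩
    obtain ⟨x, hxL, hxm⟩ := not_subset.1 (hLn m)
    obtain ⟨j, hj⟩ := mem_iUnion.1 (hKD (hLK hxL))
    have hjm : j ≠ m := by rintro rfl; exact hxm hj
    obtain ⟨U, hU, hjU, hUm⟩ := normal_exists_closure_subset (hD j) (hD m).isOpen_compl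
      (disjoint_left.1 (hdisj j m hjm))
    obtain ⟨z, hzL, hzm⟩ := nonempty_iff_ne_empty.2 hm
    have hzU : z ∉ U := fun h => hUm (subset_closure h) hzm
    obtain ⟨y, hy, hyU⟩ := exists_mem_connectedComponentIn_notMem hL hLc hU
      ⟨hxL, hjU hj⟩ (fun h => hzU (h hzL))
    have hxY : x ∈ L ∩ closure U := ⟨hxL, subset_closure (hjU hj)⟩
    have hsub := connectedComponentIn_subset (L ∩ closure U) x
    refine ⟨connectedComponentIn (L ∩ closure U) x, ⟨?_, isPreconnected_connectedComponentIn,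
      hsub.trans (inter_subset_left.trans hLK), ?_⟩, hsub.trans inter_subset_left, ?_⟩
    · have : CompactSpace ↥(L ∩ closure U) :=
        isCompact_iff_compactSpace.1 (hL.inter_right isClosed_closure)
      rw [connectedComponentIn_eq_image hxY]
      exact isClosed_connectedComponent.isCompact.image continuous_subtype_val
    · intro n hn
      have h1 : n = j := by
        by_contra hne
        exact disjoint_left.1 (hdisj n j hne) (hn (mem_connectedComponentIn hxY)) hj
      exact hyU (hjU (h1 ▸ hn hy))
    · rw [← not_nonempty_iff_eq_empty]
      rintro ⟨w, hw, hwm⟩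
      exact hUm (hsub hw).2 hwm
  choose! F hF1 hF2 hF3 using step
  let s : ℕ → Set X := fun n => Nat.rec K (fun n L => F L n) n
  have hs : ∀ n, s n ∈ S := by
    intro n
    induction n with
    | zero => exact ⟨hK, hKc, subset_rfl, hcon⟩
    | succ n ih => exact hF1 _ ih n
  obtain ⟨x, hx⟩ := IsCompact.nonempty_iInter_of_sequence_nonempty_isCompact_isClosed s
    (fun n => hF2 _ (hs n) n)
    (fun n => by
      by_contra h
      rw [not_nonempty_iff_eq_empty] at h
      exact (hs n).2.2.2 0 (h ▸ empty_subset _)) hK (fun n => (hs n).1.isClosed)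
  rw [mem_iInter] at hx
  obtain ⟨n, hn⟩ := mem_iUnion.1 (hKD (hx 0))
  exact (hF3 _ (hs n) n).subset ⟨hx (n + 1), hn⟩

/-- If all finite subfamilies of a family of closed sets in a compact Hausdorff space have
connected intersection, so has the whole family. -/
theorem isPreconnected_iInter_of_finset {X ι : Type*} [TopologicalSpace X] [CompactSpace X]
    [T2Space X] {F : ι → Set X} (hF : ∀ i, IsClosed (F i))
    (h : ∀ s : Finset ι, IsPreconnected (⋂ i ∈ s, F i)) : IsPreconnected (⋂ i, F i) := by
  have hcl : IsClosed (⋂ i, F i) := isClosed_iInter hF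
  rw [isPreconnected_closed_iff]
  intro t t' ht ht' hsub hne hne'
  by_contra hem
  rw [not_nonempty_iff_eq_empty] at hem
  obtain ⟨U, V, hU, hV, htU, htV, hUV⟩ := normal_separation (hcl.inter ht) (hcl.inter ht')
    (disjoint_left.2 fun x hx hx' => hem.subset ⟨hx.1, hx.2, hx'.2⟩)
  have hFUV : (⋂ i, F i) ⊆ U ∪ V := fun x hx =>
    (hsub hx).imp (fun h => htU ⟨hx, h⟩) (fun h => htV ⟨hx, h⟩)
  obtain ⟨s, hs⟩ := (hU.union hV).isClosed_compl.isCompact.elim_finite_subfamily_closed F hF (by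
    rw [← disjoint_iff_inter_eq_empty, disjoint_compl_left_iff_subset]
    exact hFUV)
  rw [← disjoint_iff_inter_eq_empty, disjoint_compl_left_iff_subset] at hs
  have hsubs : (⋂ i, F i) ⊆ ⋂ i ∈ s, F i := subset_iInter₂ fun i _ => iInter_subset F i
  obtain ⟨x, hx, hxt⟩ := hne
  obtain ⟨y, hy, hyt⟩ := hne'
  obtain ⟨z, -, hzU, hzV⟩ := h s U V hU hV hs ⟨x, hsubs hx, htU ⟨hx, hxt⟩⟩
    ⟨y, hsubs hy, htV ⟨hy, hyt⟩⟩
  exact disjoint_left.1 hUV hzU hzV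

/-- In a unicoherent space, continua that are pairwise nested or cover the space have connected
finite intersections. -/
theorem Unicoherent.isPreconnected_biInter {X ι : Type*} [TopologicalSpace X] [PreconnectedSpace X]
    (hX : Unicoherent X) {F : ι → Set X} (hF : ∀ i, IsClosed (F i))
    (hFc : ∀ i, IsPreconnected (F i))
    (h : ∀ i j, F i ⊆ F j ∨ F j ⊆ F i ∨ F i ∪ F j = univ) (s : Finset ι) :
    IsPreconnected (⋂ i ∈ s, F i) := by
  classical
  induction s using Finset.strongInduction with
  | H s ih =>
    by_cases hnest : ∃ i ∈ s, ∃ j ∈ s, i ≠ j ∧ F i ⊆ F j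
    · obtain ⟨i, hi, j, hj, hij, hsub⟩ := hnest
      have : (⋂ k ∈ s, F k) = ⋂ k ∈ s.erase j, F k := by
        apply Subset.antisymm
        · exact biInter_subset_biInter_left fun k hk => Finset.mem_of_mem_erase hk
        · refine subset_iInter₂ fun k hk => ?_
          by_cases hkj : k = j
          · subst hkj
            exact (biInter_subset_of_mem (Finset.mem_coe.2 (Finset.mem_erase.2 ⟨hij, hi⟩))).trans
              hsub
          · exact biInter_subset_of_mem (Finset.mem_coe.2 (Finset.mem_erase.2 ⟨hkj, hk⟩))
      rw [this]
      exact ih _ (Finset.erase_ssubset hj)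
    · push Not at hnest
      rcases s.eq_empty_or_nonempty with rfl | ⟨k, hk⟩
      · simpa using isPreconnected_univ
      have : (⋂ i ∈ s, F i) = F k ∩ ⋂ i ∈ s.erase k, F i := by
        conv_lhs => rw [← Finset.insert_erase hk]
        rw [Finset.set_biInter_insert]
      rw [this]
      refine hX _ _ (hF k) (isClosed_biInter fun i _ => hF i) (hFc k)
        (ih _ (Finset.erase_ssubset hk)) ?_
      rw [eq_univ_iff_forall]
      intro x
      by_cases hx : x ∈ F k
      · exact Or.inl hx
      · refine Or.inr (mem_iInter₂.2 fun i hi => ?_)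
        obtain ⟨hik, his⟩ := Finset.mem_erase.1 hi
        rcases h i k with h1 | h1 | h1
        · exact (hnest i his k hk hik h1).elim
        · exact (hnest k hk i his hik.symm h1).elim
        · exact ((h1.symm ▸ mem_univ x : x ∈ F i ∪ F k)).resolve_right hx

/-! ### Arcs -/

section Arc

variable {T : Type*} [MetricSpace T]

/-- The closed sets of times containing the end points, such that the path `f` takes the same value
at the two ends of every complementary interval. -/
def loopCuts (f : unitInterval → T) : Set (Set unitInterval) :=
  {C | IsClosed C ∧ 0 ∈ C ∧ 1 ∈ C ∧
    ∀ s ∈ C, ∀ t ∈ C, s < t → (∀ r ∈ C, s < r → ¬ r < t) → f s = f t}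

theorem exists_isGreatest_inter_Iic {C : Set unitInterval} (hC : IsClosed C) (h0 : 0 ∈ C)
    (t : unitInterval) : ∃ s, IsGreatest (C ∩ Iic t) s :=
  (hC.inter isClosed_Iic).isCompact.exists_isGreatest ⟨0, h0, unitInterval.nonneg t⟩

theorem exists_isLeast_inter_Ici {C : Set unitInterval} (hC : IsClosed C) (h1 : 1 ∈ C)
    (t : unitInterval) : ∃ s, IsLeast (C ∩ Ici t) s :=
  (hC.inter isClosed_Ici).isCompact.exists_isLeast ⟨1, h1, unitInterval.le_one t⟩

theorem exists_minimal_loopCuts {f : unitInterval → T} (hf : Continuous f) :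
    ∃ C, Minimal (· ∈ loopCuts f) C := by
  refine (zorn_superset_nonempty (loopCuts f) ?_ univ
    ⟨isClosed_univ, mem_univ _, mem_univ _, ?_⟩).imp fun C hC => hC.2
  swap
  · intro s _ t _ hst h
    obtain ⟨r, h1, h2⟩ := exists_between hst
    exact (h r (mem_univ r) h1 h2).elim
  intro c hc hchain hne
  have hcl : ∀ C ∈ c, IsClosed C := fun C hC => (hc hC).1
  refine ⟨⋂₀ c, ⟨isClosed_sInter hcl, fun C hC => (hc hC).2.1, fun C hC => (hc hC).2.2.1, ?_⟩,
    fun C hC => sInter_subset_of_mem hC⟩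
  intro s hs t ht hst hgap
  refine eq_of_forall_dist_le fun ε hε => ?_
  -- times close to `s` and `t` at which `f` is close to `f s` and `f t`
  have hs' : ∀ᶠ u in 𝓝 s, dist (f u) (f s) < ε / 2 :=
    (Metric.tendsto_nhds.1 (hf.tendsto s)) _ (half_pos hε)
  have ht' : ∀ᶠ u in 𝓝 t, dist (f u) (f t) < ε / 2 :=
    (Metric.tendsto_nhds.1 (hf.tendsto t)) _ (half_pos hε)
  obtain ⟨m, hsm, hmt⟩ := exists_between hst
  obtain ⟨s', hs1, hs2⟩ := exists_Ico_subset_of_mem_nhds hs' ⟨m, hsm⟩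
  obtain ⟨t', ht1, ht2⟩ := exists_Ioc_subset_of_mem_nhds ht' ⟨m, hmt⟩
  obtain ⟨u, hu1, hu2⟩ := exists_between (lt_min hs1 hsm)
  obtain ⟨v, hv1, hv2⟩ := exists_between (max_lt ht1 hmt)
  have hus' : u < s' := hu2.trans_le (min_le_left _ _)
  have hum : u < m := hu2.trans_le (min_le_right _ _)
  have hvt' : t' < v := (le_max_left _ _).trans_lt hv1
  have hvm : m < v := (le_max_right _ _).trans_lt hv1
  -- some member of the chain misses `[u, v]`
  have hcsub : ∃ C ∈ c, C ∩ Icc u v = ∅ := by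
    by_contra! hcon
    have : Nonempty c := hne.to_subtype
    obtain ⟨x, hx⟩ := IsCompact.nonempty_iInter_of_directed_nonempty_isCompact_isClosed
      (fun C : c => (C : Set unitInterval) ∩ Icc u v) (by
        rintro ⟨A, hA⟩ ⟨B, hB⟩
        rcases hchain.total hA hB with h | h
        · exact ⟨⟨A, hA⟩, subset_rfl, inter_subset_inter_left _ h⟩
        · exact ⟨⟨B, hB⟩, inter_subset_inter_left _ h, subset_rfl⟩)
      (fun C => hcon C C.2)
      (fun C => ((hcl C C.2).inter isClosed_Icc).isCompact)
      (fun C => (hcl C C.2).inter isClosed_Icc)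
    rw [mem_iInter] at hx
    obtain ⟨C0, hC0⟩ := hne
    have hxuv := (hx ⟨C0, hC0⟩).2
    exact hgap x (fun C hC => (hx ⟨C, hC⟩).1) (hu1.trans_le hxuv.1) (hxuv.2.trans_lt hv2)
  obtain ⟨C, hC, hCuv⟩ := hcsub
  obtain ⟨hCc, hC0, hC1, hCg⟩ := hc hC
  obtain ⟨p, ⟨hpC, hpu⟩, hp⟩ := exists_isGreatest_inter_Iic hCc hC0 u
  obtain ⟨q, ⟨hqC, hqv⟩, hq⟩ := exists_isLeast_inter_Ici hCc hC1 v
  have hsp : s ≤ p := hp ⟨hs C hC, hu1.le⟩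
  have hqt : q ≤ t := hq ⟨ht C hC, hv2.le⟩
  have hpq : f p = f q := by
    refine hCg p hpC q hqC ((mem_Iic.1 hpu).trans_lt ((hum.trans hvm).trans_le hqv)) ?_
    intro r hr hpr hrq
    by_cases hru : r ≤ u
    · exact absurd (hp ⟨hr, hru⟩) (not_le.2 hpr)
    by_cases hrv : v ≤ r
    · exact absurd (hq ⟨hr, hrv⟩) (not_le.2 hrq)
    · exact hCuv.subset ⟨hr, (not_le.1 hru).le, (not_le.1 hrv).le⟩
  have d1 : dist (f p) (f s) < ε / 2 := hs2 ⟨hsp, (mem_Iic.1 hpu).trans_lt hus'⟩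
  have d2 : dist (f q) (f t) < ε / 2 := ht2 ⟨hvt'.trans_le hqv, hqt⟩
  calc dist (f s) (f t) ≤ dist (f s) (f p) + dist (f p) (f t) := dist_triangle _ _ _
    _ = dist (f p) (f s) + dist (f q) (f t) := by rw [dist_comm, hpq]
    _ ≤ ε := by linarith

/-- Every path in a metric space can be replaced by a monotone one, that is, by a path with
connected fibres: remove a maximal family of disjoint loops. -/
theorem exists_monotone_path {f : unitInterval → T} (hf : Continuous f) :
    ∃ g : unitInterval → T, Continuous g ∧ g 0 = f 0 ∧ g 1 = f 1 ∧
      ∀ s t, s ≤ t → g s = g t → ∀ r ∈ Icc s t, g r = g s := by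
  obtain ⟨C, ⟨hC, h0, h1, hgap⟩, hmin⟩ := exists_minimal_loopCuts hf
  -- by minimality `f` takes equal values in `C` only at the ends of gaps
  have hgap' : ∀ s ∈ C, ∀ t ∈ C, s < t → f s = f t → ∀ r ∈ C, s < r → ¬ r < t := by
    intro s hs t ht hst hfst r hr hsr hrt
    have hmem : C \ Ioo s t ∈ loopCuts f := by
      refine ⟨hC.sdiff isOpen_Ioo, ⟨h0, fun h => absurd h.1 (not_lt.2 (unitInterval.nonneg s))⟩,
        ⟨h1, fun h => absurd h.2 (not_lt.2 (unitInterval.le_one t))⟩, ?_⟩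
      rintro u ⟨hu, hu'⟩ v ⟨hv, hv'⟩ huv hg
      by_cases hno : ∀ w ∈ C, u < w → ¬ w < v
      · exact hgap u hu v hv huv hno
      push Not at hno
      obtain ⟨w, hwC, huw, hwv⟩ := hno
      have hw : w ∈ Ioo s t := by
        by_contra hw
        exact hg w ⟨hwC, hw⟩ huw hwv
      have e1 : u ≤ s := by
        by_contra hlt
        exact hu' ⟨not_le.1 hlt, huw.trans hw.2⟩
      have e2 : t ≤ v := by
        by_contra hlt
        exact hv' ⟨hw.1.trans hwv, not_le.1 hlt⟩
      have e3 : s ≤ u := by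
        by_contra hlt
        exact hg s ⟨hs, fun h => lt_irrefl _ h.1⟩ (not_le.1 hlt) (hw.1.trans hwv)
      have e4 : v ≤ t := by
        by_contra hlt
        exact hg t ⟨ht, fun h => lt_irrefl _ h.2⟩ (huw.trans hw.2) (not_le.1 hlt)
      rw [le_antisymm e1 e3, le_antisymm e4 e2, hfst]
    exact (hmin hmem sdiff_subset hr).2 ⟨hsr, hrt⟩
  choose σ hσ using exists_isGreatest_inter_Iic hC h0
  have hσC : ∀ t, σ t ∈ C := fun t => (hσ t).1.1
  have hσle : ∀ t, σ t ≤ t := fun t => (hσ t).1.2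
  have hσmax : ∀ t, ∀ s ∈ C, s ≤ t → s ≤ σ t := fun t s hs hst => (hσ t).2 ⟨hs, hst⟩
  have hσid : ∀ t ∈ C, σ t = t := fun t ht => le_antisymm (hσle t) (hσmax t t ht le_rfl)
  have hσmono : ∀ s t, s ≤ t → σ s ≤ σ t := fun s t hst =>
    hσmax t _ (hσC s) ((hσle s).trans hst)
  -- if `σ t ≠ σ t'`, the values at both are attained on `[t, t']`
  have hkey : ∀ t t', t ≤ t' → σ t = σ t' ∨
      ∃ c ∈ Icc t t', ∃ d ∈ Icc t t', f (σ t) = f c ∧ f (σ t') = f d := by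
    intro t t' htt'
    by_cases h : t ≤ σ t'
    · right
      obtain ⟨c, ⟨hcC, hct⟩, hc⟩ := exists_isLeast_inter_Ici hC h1 t
      refine ⟨c, ⟨hct, (hc ⟨hσC t', h⟩).trans (hσle t')⟩, σ t', ⟨h, hσle t'⟩, ?_, rfl⟩
      rcases eq_or_lt_of_le ((hσle t).trans hct) with h2 | h2
      · rw [h2]
      · refine hgap _ (hσC t) _ hcC h2 fun r hr h3 h4 => ?_
        rcases le_total r t with h5 | h5
        · exact absurd (hσmax t r hr h5) (not_le.2 h3)
        · exact absurd (hc ⟨hr, h5⟩) (not_le.2 h4)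
    · left
      exact le_antisymm (hσmono t t' htt') (hσmax t _ (hσC t') (not_le.1 h).le)
  refine ⟨f ∘ σ, ?_, ?_, ?_, ?_⟩
  · rw [Metric.continuous_iff]
    intro t ε hε
    obtain ⟨δ, hδ, h⟩ := Metric.uniformContinuous_iff.1
      (CompactSpace.uniformContinuous_of_continuous hf) ε hε
    have main : ∀ u v : unitInterval, u ≤ v → dist v u < δ →
        dist ((f ∘ σ) u) ((f ∘ σ) v) < ε := by
      intro u v huv hd
      rcases hkey u v huv with h2 | ⟨c, hc, d, hd', e1, e2⟩
      · simp only [Function.comp_apply, h2, dist_self, hε]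
      · simp only [Function.comp_apply, e1, e2]
        refine h (lt_of_le_of_lt ?_ hd)
        rw [Subtype.dist_eq, Subtype.dist_eq, Real.dist_eq, Real.dist_eq, abs_le]
        have hcc : (u : ℝ) ≤ c ∧ (c : ℝ) ≤ v := hc
        have hdd : (u : ℝ) ≤ d ∧ (d : ℝ) ≤ v := hd'
        rw [abs_of_nonneg (by linarith [hcc.1, hcc.2] : (0 : ℝ) ≤ v - u)]
        constructor <;> linarith [hcc.1, hcc.2, hdd.1, hdd.2]
    refine ⟨δ, hδ, fun u hu => ?_⟩
    rcases le_total u t with h2 | h2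
    · exact main u t h2 (by rwa [dist_comm])
    · rw [dist_comm]; exact main t u h2 hu
  · simp only [Function.comp_apply, hσid 0 h0]
  · simp only [Function.comp_apply, hσid 1 h1]
  · intro s t hst hg r hr
    simp only [Function.comp_apply] at hg ⊢
    have h2 := hσmono s r hr.1
    have h3 := hσmono r t hr.2
    rcases eq_or_lt_of_le h2 with h4 | h4
    · rw [h4]
    rcases eq_or_lt_of_le h3 with h5 | h5
    · rw [h5, hg]
    exact (hgap' _ (hσC s) _ (hσC t) (h4.trans h5) hg _ (hσC r) h4 h5).elim

/-- The largest distance to `g q` along the path `g` on the time interval `[q, t]`. -/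
noncomputable def runningDist (g : unitInterval → T) (q t : unitInterval) : ℝ :=
  sSup ((fun r => dist (g q) (g (max q (min r t)))) '' univ)

theorem continuous_runningDist {g : unitInterval → T} (hg : Continuous g) (q : unitInterval) :
    Continuous (runningDist g q) := by
  refine IsCompact.continuous_sSup (f := fun t r => dist (g q) (g (max q (min r t)))) isCompact_univ
    ?_
  fun_prop

theorem bddAbove_runningDist {g : unitInterval → T} (hg : Continuous g) (q t : unitInterval) :
    BddAbove ((fun r => dist (g q) (g (max q (min r t)))) '' univ) :=
  (isCompact_univ.image (by fun_prop)).bddAbove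

theorem dist_le_runningDist {g : unitInterval → T} (hg : Continuous g) {q r t : unitInterval}
    (hqr : q ≤ r) (hrt : r ≤ t) : dist (g q) (g r) ≤ runningDist g q t :=
  le_csSup (bddAbove_runningDist hg q t) ⟨r, mem_univ r, by simp [min_eq_left hrt, hqr]⟩

theorem runningDist_le {g : unitInterval → T} {q t : unitInterval} {c : ℝ}
    (hc : 0 ≤ c) (h : ∀ r, q ≤ r → r ≤ t → dist (g q) (g r) ≤ c) : runningDist g q t ≤ c := by
  refine csSup_le (image_nonempty.2 univ_nonempty) ?_
  rintro _ ⟨r, -, rfl⟩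
  rcases le_total q (min r t) with h2 | h2
  · simp only [max_eq_right h2]
    exact h _ h2 (min_le_right _ _)
  · simpa only [max_eq_left h2, dist_self] using hc

theorem runningDist_nonneg {g : unitInterval → T} (hg : Continuous g) (q t : unitInterval) :
    0 ≤ runningDist g q t := by
  refine le_csSup_of_le (bddAbove_runningDist hg q t) ⟨0, mem_univ _, rfl⟩ dist_nonneg

theorem runningDist_mono {g : unitInterval → T} (hg : Continuous g) (q : unitInterval) :
    Monotone (runningDist g q) := fun _ t hst =>
  runningDist_le (runningDist_nonneg hg q t) fun _ h1 h2 => dist_le_runningDist hg h1 (h2.trans hst)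

/-- A nonconstant monotone path runs through an arc. The parametrisation is by a weighted sum of
running distances to countably many points of the path. -/
theorem isArcBetween_of_monotone_path [CompactSpace T] {g : unitInterval → T} (hg : Continuous g)
    (hmono : ∀ s t, s ≤ t → g s = g t → ∀ r ∈ Icc s t, g r = g s) (hne : g 0 ≠ g 1) :
    ∃ A, IsArcBetween A (g 0) (g 1) := by
  obtain ⟨q, hq⟩ := TopologicalSpace.exists_dense_seq unitInterval
  set M := Metric.diam (univ : Set T)
  have hM : ∀ x y : T, dist x y ≤ M := fun x y =>
    Metric.dist_le_diam_of_mem isCompact_univ.isBounded (mem_univ x) (mem_univ y)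
  have hM0 : 0 ≤ M := Metric.diam_nonneg
  have hbound : ∀ n t, runningDist g (q n) t * (1 / 2) ^ n ≤ M * (1 / 2) ^ n := fun n t =>
    mul_le_mul_of_nonneg_right (runningDist_le hM0 fun _ _ _ => hM _ _) (by positivity)
  have hbound' : ∀ n t, ‖runningDist g (q n) t * (1 / 2) ^ n‖ ≤ M * (1 / 2) ^ n := fun n t => by
    rw [Real.norm_of_nonneg (mul_nonneg (runningDist_nonneg hg _ _) (by positivity))]
    exact hbound n t
  have hsumM : Summable fun n : ℕ => M * (1 / 2 : ℝ) ^ n :=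
    (summable_geometric_of_lt_one (by norm_num) (by norm_num)).mul_left M
  have hsum : ∀ t, Summable fun n => runningDist g (q n) t * (1 / 2) ^ n := fun t =>
    Summable.of_norm_bounded hsumM (fun n => hbound' n t)
  set h : unitInterval → ℝ := fun t => ∑' n, runningDist g (q n) t * (1 / 2) ^ n with hh
  have hcont : Continuous h :=
    continuous_tsum (fun n => (continuous_runningDist hg (q n)).mul continuous_const) hsumM hbound'
  have hle : ∀ s t, s ≤ t → ∀ n, runningDist g (q n) s * (1 / 2) ^ n ≤
      runningDist g (q n) t * (1 / 2) ^ n := fun s t hst n =>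
    mul_le_mul_of_nonneg_right (runningDist_mono hg _ hst) (by positivity)
  have hhmono : Monotone h := fun s t hst => (hsum s).tsum_le_tsum (hle s t hst) (hsum t)
  -- the fibres of `h` and of `g` agree
  have heq : ∀ s t, s ≤ t → g s = g t → h s = h t := by
    intro s t hst hgst
    refine le_antisymm (hhmono hst) ((hsum t).tsum_le_tsum (fun n => ?_) (hsum s))
    refine mul_le_mul_of_nonneg_right (runningDist_le (runningDist_nonneg hg _ _) ?_)
      (by positivity)
    intro r h1 h2
    rcases le_total r s with h3 | h3
    · exact dist_le_runningDist hg h1 h3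
    · rw [hmono s t hst hgst r ⟨h3, h2⟩]
      rcases le_total (q n) s with h4 | h4
      · exact dist_le_runningDist hg h4 le_rfl
      · rw [hmono s t hst hgst (q n) ⟨h4, h1.trans h2⟩, dist_self]
        exact runningDist_nonneg hg _ _
  have hlt : ∀ s t, s ≤ t → g s ≠ g t → h s < h t := by
    intro s t hst hgst
    have hst' : s < t := lt_of_le_of_ne hst fun h => hgst (h ▸ rfl)
    have hev : ∀ᶠ u in 𝓝 s, g u ≠ g t := (hg.tendsto s).eventually_ne hgst
    obtain ⟨u, hsu, hu⟩ := exists_Ico_subset_of_mem_nhds hev ⟨t, hst'⟩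
    obtain ⟨w, hw1, hw2⟩ := exists_between (lt_min hsu hst')
    obtain ⟨n, hn1, hn2⟩ := hq.exists_mem_open isOpen_Ioo
      (show (Ioo s (min u t)).Nonempty from ⟨w, hw1, hw2⟩)
    have hn3 : q n < u := hn2.trans_le (min_le_left _ _)
    have hn4 : q n < t := hn2.trans_le (min_le_right _ _)
    refine (hsum s).tsum_lt_tsum (i := n) (hle s t hst) ?_ (hsum t)
    refine mul_lt_mul_of_pos_right (lt_of_le_of_lt (b := 0) ?_ ?_) (by positivity)
    · exact runningDist_le le_rfl fun r h1 h2 => absurd (h1.trans h2) (not_le.2 hn1)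
    · exact (dist_pos.2 (hu ⟨hn1.le, hn3⟩)).trans_le (dist_le_runningDist hg hn4.le le_rfl)
  have hiff : ∀ s t, h s = h t ↔ g s = g t := by
    have aux : ∀ s t, s ≤ t → (h s = h t ↔ g s = g t) := fun s t hst =>
      ⟨fun e => by_contra fun hne => (hlt s t hst hne).ne e, heq s t hst⟩
    intro s t
    rcases le_total s t with hst | hst
    · exact aux s t hst
    · rw [eq_comm, aux t s hst, eq_comm]
  have h01 : h 0 < h 1 := hlt 0 1 (unitInterval.nonneg 1) hne
  -- normalise `h` to a surjection onto the unit interval and factor `g` through it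
  set k : unitInterval → unitInterval := fun t => ⟨(h t - h 0) / (h 1 - h 0),
    div_nonneg (sub_nonneg.2 (hhmono (unitInterval.nonneg t))) (sub_pos.2 h01).le,
    (div_le_one (sub_pos.2 h01)).2 (sub_le_sub_right (hhmono (unitInterval.le_one t)) _)⟩ with hk
  have hkc : Continuous k := by
    refine Continuous.subtype_mk ?_ _
    exact (hcont.sub continuous_const).div_const _
  have hk0 : k 0 = 0 := Subtype.ext (by simp [hk])
  have hk1 : k 1 = 1 := Subtype.ext (by simp [hk, (sub_pos.2 h01).ne'])
  have hksurj : Function.Surjective k := by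
    intro y
    have hy := intermediate_value_univ (0 : unitInterval) 1 hkc
    rw [hk0, hk1] at hy
    exact hy ⟨unitInterval.nonneg y, unitInterval.le_one y⟩
  have hkiff : ∀ s t, k s = k t ↔ g s = g t := by
    intro s t
    rw [← hiff, Subtype.ext_iff]
    simp only [hk]
    rw [div_left_inj' (sub_pos.2 h01).ne', sub_left_inj]
  have hquot : IsQuotientMap k := hkc.isClosedMap.isQuotientMap hkc hksurj
  choose c hc using hksurj
  have hgc : ∀ t, g (c (k t)) = g t := fun t => (hkiff _ _).1 (hc (k t))
  refine ⟨range (g ∘ c), g ∘ c, ?_, ?_, ?_, ?_, rfl⟩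
  · rw [hquot.continuous_iff]
    exact hg.congr fun t => (hgc t).symm
  · intro x y hxy
    have := (hkiff (c x) (c y)).2 hxy
    rwa [hc, hc] at this
  · have := hgc 0; rwa [hk0] at this
  · have := hgc 1; rwa [hk1] at this

theorem exists_isArcBetween [CompactSpace T] [PathConnectedSpace T] {x y : T} (hxy : x ≠ y) :
    ∃ A, IsArcBetween A x y := by
  obtain ⟨γ⟩ := PathConnectedSpace.joined x y
  obtain ⟨g, hg, h0, h1, hmono⟩ := exists_monotone_path γ.continuous
  rw [γ.source] at h0
  rw [γ.target] at h1
  subst h0 h1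
  exact isArcBetween_of_monotone_path hg hmono hxy

/-- If any two points are separated by a point, an arc is contained in every other arc with the
same end points: an excursion from the latter would contain a point separating the two ends of
the excursion. -/
theorem IsArcBetween.subset (hsep : ∀ u v : T, u ≠ v → ∃ t, Separates {t} u v) {A B : Set T}
    {x y : T} (hA : IsArcBetween A x y) (hB : IsArcBetween B x y) : A ⊆ B := by
  obtain ⟨e, he, hei, he0, he1, rfl⟩ := hA
  obtain ⟨e', he', -, he0', he1', rfl⟩ := hB
  rintro _ ⟨s, rfl⟩
  by_contra hs
  have hBc : IsClosed (range e') := (isCompact_range he').isClosed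
  have hC : IsClosed (e ⁻¹' range e') := hBc.preimage he
  obtain ⟨u, ⟨huB, hus⟩, hu⟩ := exists_isGreatest_inter_Iic hC
    (show (0 : unitInterval) ∈ e ⁻¹' range e' from ⟨0, he0'.trans he0.symm⟩) s
  obtain ⟨v, ⟨hvB, hsv⟩, hv⟩ := exists_isLeast_inter_Ici hC
    (show (1 : unitInterval) ∈ e ⁻¹' range e' from ⟨1, he1'.trans he1.symm⟩) s
  have hus' : u < s := lt_of_le_of_ne hus fun h => hs (h ▸ huB)
  have hsv' : s < v := lt_of_le_of_ne hsv fun h => hs (h ▸ hvB)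
  obtain ⟨t, ht⟩ := hsep (e u) (e v) (hei.ne (hus'.trans hsv').ne)
  have htA : t ∈ e '' Icc u v := by
    by_contra h
    exact not_separates_of_isPreconnected (isPreconnected_Icc.image e he.continuousOn)
      (disjoint_singleton_right.2 h) (mem_image_of_mem e ⟨le_rfl, (hus'.trans hsv').le⟩)
      (mem_image_of_mem e ⟨(hus'.trans hsv').le, le_rfl⟩) ht
  obtain ⟨r, ⟨hur, hrv⟩, rfl⟩ := htA
  have hrB : e r ∉ range e' := by
    intro hr
    rcases le_total r s with h | h
    · have : r = u := le_antisymm (hu ⟨hr, h⟩) hur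
      exact ht.1 (by simp [this])
    · have : r = v := le_antisymm hrv (hv ⟨hr, h⟩)
      exact ht.2.1 (by simp [this])
  exact not_separates_of_isPreconnected (isPreconnected_range he')
    (disjoint_singleton_right.2 hrB) huB hvB ht

/-- A Peano continuum in which any two points are separated by a third one is a dendrite. -/
theorem isMetricTree_of_separates [CompactSpace T] [PathConnectedSpace T] [LocallyConnectedSpace T]
    [Nontrivial T] (hsep : ∀ u v : T, u ≠ v → ∃ t, Separates {t} u v) : IsMetricTree T where
  compact := inferInstance
  connected := inferInstance
  locallyConnected := inferInstance
  nontrivial := inferInstance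
  uniqueArc x y hxy := by
    obtain ⟨A, hA⟩ := exists_isArcBetween hxy
    exact ⟨A, hA, fun B hB => (hB.subset hsep hA).antisymm (hA.subset hsep hB)⟩

end Arc

/-! ### Quotients of continua by families of separating continua -/

section Decomposition

variable {X : Type*} [TopologicalSpace X]

/-- A family of pairwise disjoint nonempty closed connected sets. -/
structure DisjointContinua (𝒢 : Set (Set X)) : Prop where
  isClosed : ∀ γ ∈ 𝒢, IsClosed γ
  isPreconnected : ∀ γ ∈ 𝒢, IsPreconnected γ
  nonempty : ∀ γ ∈ 𝒢, γ.Nonempty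
  disjoint : ∀ γ ∈ 𝒢, ∀ γ' ∈ 𝒢, γ ≠ γ' → Disjoint γ γ'

/-- No member of the family `𝒢` separates `p` from `q`. -/
def NotSeparated (𝒢 : Set (Set X)) (p q : X) : Prop :=
  ∀ γ ∈ 𝒢, ¬ Separates γ p q

theorem NotSeparated.refl (𝒢 : Set (Set X)) (p : X) : NotSeparated 𝒢 p p := fun _ _ h =>
  h.2.2 (mem_connectedComponentIn h.1)

theorem NotSeparated.symm {𝒢 : Set (Set X)} {p q : X} (h : NotSeparated 𝒢 p q) :
    NotSeparated 𝒢 q p := fun γ hγ h' => h γ hγ h'.symm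

/-- A set `γ` together with the component of its complement that contains `q`. -/
def fillAt (γ : Set X) (q : X) : Set X := γ ∪ connectedComponentIn γᶜ q

theorem isClosed_fillAt {γ : Set X} (hγ : IsClosed γ) (q : X) : IsClosed (fillAt γ q) := by
  refine closure_subset_iff_isClosed.1 ?_
  rw [fillAt, closure_union, hγ.closure_eq]
  exact union_subset subset_union_left
    (closure_connectedComponentIn_subset.trans (union_comm _ _).subset)

theorem mem_fillAt_iff {γ : Set X} {p q : X} (hq : q ∉ γ) : p ∈ fillAt γ q ↔ ¬ Separates γ p q := by
  constructor
  · rintro (h | h) hs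
    · exact hs.1 h
    · exact hs.symm.2.2 h
  · intro h
    by_contra hp
    rw [fillAt, mem_union, not_or] at hp
    exact h (Separates.symm ⟨hq, hp.1, hp.2⟩)

theorem setOf_notSeparated_eq (𝒢 : Set (Set X)) (q : X) :
    {p | NotSeparated 𝒢 p q} = ⋂ γ : {γ // γ ∈ 𝒢 ∧ q ∉ γ}, fillAt (γ : Set X) q := by
  ext p
  rw [mem_iInter]
  constructor
  · rintro h ⟨γ, hγ, hq⟩
    exact (mem_fillAt_iff hq).2 (h γ hγ)
  · intro h γ hγ hs
    exact (mem_fillAt_iff hs.2.1).1 (h ⟨γ, hγ, hs.2.1⟩) hs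

theorem isClosed_setOf_notSeparated {𝒢 : Set (Set X)} (h𝒢 : ∀ γ ∈ 𝒢, IsClosed γ) (q : X) :
    IsClosed {p | NotSeparated 𝒢 p q} := by
  rw [setOf_notSeparated_eq]
  exact isClosed_iInter fun γ => isClosed_fillAt (h𝒢 _ γ.2.1) q

theorem connectedComponentIn_eq_of_not_separates {γ : Set X} {p q : X} (hp : p ∉ γ) (hq : q ∉ γ)
    (h : ¬ Separates γ p q) : connectedComponentIn γᶜ p = connectedComponentIn γᶜ q := by
  by_contra hne
  exact h ⟨hp, hq, fun hmem => hne (connectedComponentIn_eq hmem)⟩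

/-- The classes of `NotSeparated 𝒢` form a decomposition, and each member of `𝒢` is a class, as soon
as every member of `𝒢` can be separated from any point outside by members of `𝒢`. -/
theorem NotSeparated.trans {𝒢 : Set (Set X)}
    (hB : ∀ γ ∈ 𝒢, ∀ q ∈ γ, ∀ p ∉ γ, ¬ NotSeparated 𝒢 p q) {p q r : X}
    (hpq : NotSeparated 𝒢 p q) (hqr : NotSeparated 𝒢 q r) : NotSeparated 𝒢 p r := by
  intro γ hγ hs
  by_cases hq : q ∈ γ
  · exact hB γ hγ q hq p hs.1 hpq
  · refine hs.2.2 ?_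
    rw [connectedComponentIn_eq_of_not_separates hs.1 hq (hpq γ hγ),
      connectedComponentIn_eq_of_not_separates hq hs.2.1 (hqr γ hγ)]
    exact mem_connectedComponentIn hs.2.1

/-- The equivalence relation of not being separated by a member of `𝒢`. -/
def notSeparatedSetoid (𝒢 : Set (Set X))
    (hB : ∀ γ ∈ 𝒢, ∀ q ∈ γ, ∀ p ∉ γ, ¬ NotSeparated 𝒢 p q) : Setoid X where
  r := NotSeparated 𝒢
  iseqv := ⟨NotSeparated.refl 𝒢, NotSeparated.symm, NotSeparated.trans hB⟩

theorem NotSeparated.mem_connectedComponentIn {𝒢 : Set (Set X)}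
    (hB : ∀ γ ∈ 𝒢, ∀ q ∈ γ, ∀ p ∉ γ, ¬ NotSeparated 𝒢 p q) {γ : Set X} (hγ : γ ∈ 𝒢) {c p q : X}
    (hpq : NotSeparated 𝒢 p q) (hp : p ∈ connectedComponentIn γᶜ c) :
    q ∈ connectedComponentIn γᶜ c := by
  have hpγ : p ∉ γ := connectedComponentIn_subset _ _ hp
  have hqγ : q ∉ γ := fun hq => hB γ hγ q hq p hpγ hpq
  rw [connectedComponentIn_eq hp, connectedComponentIn_eq_of_not_separates hpγ hqγ (hpq γ hγ)]
  exact _root_.mem_connectedComponentIn hqγ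

theorem DisjointContinua.notSeparated_of_mem {𝒢 : Set (Set X)} (h𝒢 : DisjointContinua 𝒢)
    {γ : Set X} (hγ : γ ∈ 𝒢) {p q : X} (hp : p ∈ γ) (hq : q ∈ γ) : NotSeparated 𝒢 p q := by
  intro γ' hγ'
  by_cases h : γ = γ'
  · subst h; exact fun hs => hs.1 hp
  · exact not_separates_of_isPreconnected (h𝒢.isPreconnected _ hγ) (h𝒢.disjoint _ hγ _ hγ' h) hp hq

/-- A compact Hausdorff continuous image of a compact metrizable space is metrizable: its algebra of
continuous functions embeds in a separable one. -/
theorem metrizableSpace_of_surjective {T : Type*} [CompactSpace X]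
    [TopologicalSpace.MetrizableSpace X] [TopologicalSpace T] [CompactSpace T]
    [T2Space T] {π : X → T} (hπ : Continuous π)
    (hs : Function.Surjective π) : TopologicalSpace.MetrizableSpace T := by
  let Φ : C(T, ℝ) → C(X, ℝ) := fun g => g.comp ⟨π, hπ⟩
  have hΦ : Isometry Φ := by
    refine Isometry.of_dist_eq fun g g' => le_antisymm ?_ ?_
    · rw [ContinuousMap.dist_le dist_nonneg]
      exact fun x => ContinuousMap.dist_apply_le_dist (f := g) (g := g') (π x)
    · rw [ContinuousMap.dist_le dist_nonneg]
      intro t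
      obtain ⟨x, rfl⟩ := hs t
      exact ContinuousMap.dist_apply_le_dist (f := Φ g) (g := Φ g') x
  let := TopologicalSpace.metrizableSpaceMetric X
  have : SecondCountableTopology C(T, ℝ) := hΦ.isEmbedding.secondCountableTopology
  refine Metric.PiNatEmbed.TopologicalSpace.MetrizableSpace.of_countable_separating
    (Y := fun _ => ℝ) (fun n => TopologicalSpace.denseSeq C(T, ℝ) n) (fun n => map_continuous _) ?_
  intro s t hst
  obtain ⟨g, hg0, hg1, -⟩ := exists_continuous_zero_one_of_isClosed (isClosed_singleton (x := s))
    (isClosed_singleton (x := t)) (disjoint_singleton.2 hst)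
  obtain ⟨_, ⟨n, rfl⟩, hn⟩ := Metric.mem_closure_iff.1
    (TopologicalSpace.denseRange_denseSeq C(T, ℝ) g) (1 / 2) (by norm_num)
  refine ⟨n, fun heq => ?_⟩
  have h1 := (ContinuousMap.dist_apply_le_dist (f := g)
    (g := TopologicalSpace.denseSeq C(T, ℝ) n) s).trans_lt hn
  have h2 := (ContinuousMap.dist_apply_le_dist (f := g)
    (g := TopologicalSpace.denseSeq C(T, ℝ) n) t).trans_lt hn
  have e0 : g s = 0 := hg0 rfl
  have e1 : g t = 1 := hg1 rfl
  rw [Real.dist_eq, abs_lt] at h1 h2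
  rw [heq] at h1
  rw [e0] at h1
  rw [e1] at h2
  linarith [h1.1, h1.2, h2.1, h2.2]

theorem IsQuotientMap.locallyConnectedSpace {T : Type*} [TopologicalSpace T]
    [LocallyConnectedSpace X] {π : X → T} (hπ : IsQuotientMap π) : LocallyConnectedSpace T := by
  rw [locallyConnectedSpace_iff_connectedComponentIn_open]
  intro F hF t _
  rw [← hπ.isOpen_preimage, isOpen_iff_forall_mem_open]
  intro x hx
  have hx' : π x ∈ connectedComponentIn F t := hx
  have hxF : x ∈ π ⁻¹' F := connectedComponentIn_subset F t hx'
  refine ⟨connectedComponentIn (π ⁻¹' F) x, ?_, (hF.preimage hπ.continuous).connectedComponentIn,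
    mem_connectedComponentIn hxF⟩
  rw [← image_subset_iff, connectedComponentIn_eq hx']
  exact (isPreconnected_connectedComponentIn.image _ hπ.continuous.continuousOn)
    |>.subset_connectedComponentIn (mem_image_of_mem _ (mem_connectedComponentIn hxF))
      (image_subset_iff.2 (connectedComponentIn_subset _ _))

variable [ConnectedSpace X] [LocallyConnectedSpace X]

theorem DisjointContinua.fillAt_nested_or_cover {𝒢 : Set (Set X)} (h𝒢 : DisjointContinua 𝒢) {q : X}
    {γ₁ γ₂ : Set X} (h₁ : γ₁ ∈ 𝒢) (h₂ : γ₂ ∈ 𝒢) (hq₁ : q ∉ γ₁) (hq₂ : q ∉ γ₂) :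
    fillAt γ₁ q ⊆ fillAt γ₂ q ∨ fillAt γ₂ q ⊆ fillAt γ₁ q ∨ fillAt γ₁ q ∪ fillAt γ₂ q = univ := by
  by_cases heq : γ₁ = γ₂
  · subst heq; exact Or.inl subset_rfl
  have hdisj := h𝒢.disjoint _ h₁ _ h₂ heq
  -- if the component of `q` in the complement of `γ` misses `γ'`, the fillings are nested
  have key : ∀ γ ∈ 𝒢, ∀ γ' ∈ 𝒢, q ∉ γ → q ∉ γ' → Disjoint γ γ' →
      Disjoint γ' (connectedComponentIn γᶜ q) → fillAt γ q ⊆ fillAt γ' q := by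
    intro γ hγ γ' hγ' hq hq' hd hd'
    refine subset_trans ?_ subset_union_right
    refine (isPreconnected_union_connectedComponentIn (h𝒢.isClosed _ hγ) (h𝒢.isPreconnected _ hγ)
      (h𝒢.nonempty _ hγ) q).subset_connectedComponentIn (Or.inr (mem_connectedComponentIn hq)) ?_
    rintro x (hx | hx) hx'
    · exact disjoint_left.1 hd hx hx'
    · exact disjoint_left.1 hd' hx' hx
  have hsub : ∀ γ ∈ 𝒢, ∀ γ' ∈ 𝒢, Disjoint γ γ' → ¬ Disjoint γ' (connectedComponentIn γᶜ q) →
      γ' ⊆ connectedComponentIn γᶜ q := by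
    intro γ hγ γ' hγ' hd hd'
    obtain ⟨x, hx, hx'⟩ := not_disjoint_iff.1 hd'
    rw [connectedComponentIn_eq hx']
    exact (h𝒢.isPreconnected _ hγ').subset_connectedComponentIn hx
      (fun y hy hy' => disjoint_left.1 hd hy' hy)
  by_cases hd₁ : Disjoint γ₂ (connectedComponentIn γ₁ᶜ q)
  · exact Or.inl (key _ h₁ _ h₂ hq₁ hq₂ hdisj hd₁)
  by_cases hd₂ : Disjoint γ₁ (connectedComponentIn γ₂ᶜ q)
  · exact Or.inr (Or.inl (key _ h₂ _ h₁ hq₂ hq₁ hdisj.symm hd₂))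
  have hs₁ := hsub _ h₁ _ h₂ hdisj hd₁
  have hs₂ := hsub _ h₂ _ h₁ hdisj.symm hd₂
  right; right
  rw [eq_univ_iff_forall]
  intro x
  by_cases hx : x ∈ fillAt γ₁ q
  · exact Or.inl hx
  refine Or.inr (Or.inr ?_)
  rw [fillAt, mem_union, not_or] at hx
  obtain ⟨c, hc⟩ := h𝒢.nonempty _ h₁
  rw [connectedComponentIn_eq (hs₂ hc)]
  refine (isPreconnected_union_connectedComponentIn (h𝒢.isClosed _ h₁) (h𝒢.isPreconnected _ h₁)
      (h𝒢.nonempty _ h₁) x).subset_connectedComponentIn (Or.inl hc) ?_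
    (Or.inr (mem_connectedComponentIn hx.1))
  rintro y (hy | hy) hy'
  · exact disjoint_left.1 hdisj hy hy'
  · have h3 := hs₁ hy'
    have h4 : x ∈ connectedComponentIn γ₁ᶜ x := mem_connectedComponentIn hx.1
    rw [connectedComponentIn_eq hy, ← connectedComponentIn_eq h3] at h4
    exact hx.2 h4

/-- In a unicoherent locally connected continuum, the set of points not separated from `q` by a
family of disjoint continua is connected. -/
theorem DisjointContinua.isPreconnected_setOf_notSeparated [CompactSpace X] [T2Space X]
    (hX : Unicoherent X) {𝒢 : Set (Set X)} (h𝒢 : DisjointContinua 𝒢) (q : X) :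
    IsPreconnected {p | NotSeparated 𝒢 p q} := by
  rw [setOf_notSeparated_eq]
  have hcl : ∀ γ : {γ // γ ∈ 𝒢 ∧ q ∉ γ}, IsClosed (fillAt (γ : Set X) q) := fun γ =>
    isClosed_fillAt (h𝒢.isClosed _ γ.2.1) q
  refine isPreconnected_iInter_of_finset hcl (hX.isPreconnected_biInter hcl (fun γ => ?_) ?_)
  · exact isPreconnected_union_connectedComponentIn (h𝒢.isClosed _ γ.2.1)
      (h𝒢.isPreconnected _ γ.2.1) (h𝒢.nonempty _ γ.2.1) q
  · exact fun γ γ' => h𝒢.fillAt_nested_or_cover γ.2.1 γ'.2.1 γ.2.2 γ'.2.2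

/-- The quotient of a path connected, locally connected continuum by the relation of not being
separated by a suitable family of disjoint continua is a dendrite. -/
theorem DisjointContinua.exists_isMetricTree {X : Type} [TopologicalSpace X] [CompactSpace X]
    [TopologicalSpace.MetrizableSpace X] [PathConnectedSpace X] [LocallyConnectedSpace X]
    {𝒢 : Set (Set X)} (h𝒢 : DisjointContinua 𝒢)
    (hB : ∀ γ ∈ 𝒢, ∀ q ∈ γ, ∀ p ∉ γ, ¬ NotSeparated 𝒢 p q) (hne : ∃ p q, ¬ NotSeparated 𝒢 p q) :
    ∃ (T : Type) (_ : MetricSpace T) (π : X → T), IsMetricTree T ∧ Continuous π ∧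
      Function.Surjective π ∧ ∀ p q, π p = π q ↔ NotSeparated 𝒢 p q := by
  let s := notSeparatedSetoid 𝒢 hB
  let T := Quotient s
  let π : X → T := Quotient.mk s
  have hπ : ∀ p q, π p = π q ↔ NotSeparated 𝒢 p q := fun p q => Quotient.eq
  have hq : IsQuotientMap π := isQuotientMap_quotient_mk'
  have hsurj : Function.Surjective π := hq.surjective
  -- components of complements of members of the family are saturated
  have hsat : ∀ γ ∈ 𝒢, ∀ c, π ⁻¹' (π '' connectedComponentIn γᶜ c) = connectedComponentIn γᶜ c := by
    intro γ hγ c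
    refine Subset.antisymm ?_ (subset_preimage_image _ _)
    rintro y ⟨x, hx, hxy⟩
    exact ((hπ x y).1 hxy).mem_connectedComponentIn hB hγ hx
  have hopen : ∀ γ ∈ 𝒢, ∀ c, IsOpen (π '' connectedComponentIn γᶜ c) := by
    intro γ hγ c
    rw [← hq.isOpen_preimage, hsat γ hγ c]
    exact (h𝒢.isClosed γ hγ).isOpen_compl.connectedComponentIn
  have hdisj : ∀ γ ∈ 𝒢, ∀ p q, Separates γ p q →
      Disjoint (π '' connectedComponentIn γᶜ p) (π '' connectedComponentIn γᶜ q) := by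
    intro γ hγ p q hs
    rw [disjoint_left]
    rintro _ ⟨x, hx, rfl⟩ hy
    have hy' : x ∈ connectedComponentIn γᶜ q := (hsat γ hγ q).subset hy
    refine hs.2.2 ?_
    rw [connectedComponentIn_eq hx, ← connectedComponentIn_eq hy']
    exact mem_connectedComponentIn hs.2.1
  have hsep : ∀ u v : T, u ≠ v → ∃ γ ∈ 𝒢, ∃ p q, π p = u ∧ π q = v ∧ Separates γ p q := by
    intro u v huv
    obtain ⟨p, rfl⟩ := hsurj u
    obtain ⟨q, rfl⟩ := hsurj v
    rw [Ne, hπ, NotSeparated] at huv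
    push Not at huv
    obtain ⟨γ, hγ, hs⟩ := huv
    exact ⟨γ, hγ, p, q, rfl, rfl, hs⟩
  have : T2Space T := by
    refine ⟨fun u v huv => ?_⟩
    obtain ⟨γ, hγ, p, q, rfl, rfl, hs⟩ := hsep u v huv
    exact ⟨_, _, hopen γ hγ p, hopen γ hγ q, mem_image_of_mem _ (mem_connectedComponentIn hs.1),
      mem_image_of_mem _ (mem_connectedComponentIn hs.2.1), hdisj γ hγ p q hs⟩
  have : CompactSpace T := Quotient.compactSpace
  have : PathConnectedSpace T := Quotient.instPathConnectedSpace
  have : LocallyConnectedSpace T := hq.locallyConnectedSpace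
  have : TopologicalSpace.MetrizableSpace T := metrizableSpace_of_surjective hq.continuous hsurj
  have : Nontrivial T := by
    obtain ⟨p, q, hpq⟩ := hne
    exact ⟨π p, π q, fun h => hpq ((hπ p q).1 h)⟩
  let m : MetricSpace T := TopologicalSpace.metrizableSpaceMetric T
  refine ⟨T, m, π, isMetricTree_of_separates fun u v huv => ?_, hq.continuous, hsurj, hπ⟩
  obtain ⟨γ, hγ, p, q, rfl, rfl, hs⟩ := hsep u v huv
  obtain ⟨z, hz⟩ := h𝒢.nonempty γ hγ
  have hzγ : ∀ x, π x = π z ↔ x ∈ γ := by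
    intro x
    rw [hπ]
    exact ⟨fun h => by_contra fun hx => hB γ hγ z hz x hx h,
      fun hx => h𝒢.notSeparated_of_mem hγ hx hz⟩
  have hopen' : IsOpen (π '' fillAt γ p)ᶜ :=
    ((isClosed_fillAt (h𝒢.isClosed γ hγ) p).isCompact.image hq.continuous).isClosed.isOpen_compl
  refine ⟨π z, separates_of_isOpen (hopen γ hγ p) hopen' ?_ ?_
    (mem_image_of_mem _ (mem_connectedComponentIn hs.1)) ?_ ?_ ?_⟩
  · rw [disjoint_compl_right_iff_subset]
    exact image_mono subset_union_right
  · intro t ht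
    by_cases h : t ∈ π '' fillAt γ p
    · obtain ⟨x, hx | hx, rfl⟩ := h
      · exact (ht ((hzγ x).2 hx)).elim
      · exact Or.inl (mem_image_of_mem _ hx)
    · exact Or.inr h
  · exact fun h => hs.1 ((hzγ p).1 h)
  · rintro ⟨x, hx | hx, hxq⟩
    · exact hs.2.1 ((hzγ q).1 (hxq ▸ (hzγ x).2 hx))
    · exact hs.2.2 (((hπ x q).1 hxq).mem_connectedComponentIn hB hγ hx)
  · exact fun h => hs.2.1 ((hzγ q).1 h)

end Decomposition

/-! ### The Lozi map on the triangle -/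

/-- The parameters `a`, `b` of a Lozi map in the Misiurewicz set, together with the number `ν` for
which `-ν` is the unstable eigenvalue at the fixed point `X`. The condition `2a + b < 4` becomes
`ν < 2`. -/
structure LoziParams (a b ν : ℝ) : Prop where
  b_pos : 0 < b
  a_pos : 0 < a
  ν_pos : 0 < ν
  sq_ν : ν ^ 2 = a * ν + b
  ν_lt : ν < 2
  lt_sq_a : 2 + 2 * b + b ^ 2 / 2 < a ^ 2

theorem loziParams_of_mem {a b : ℝ} (hab : (a, b) ∈ misiurewiczSet) :
    LoziParams a b ((a + √(a ^ 2 + 4 * b)) / 2) := by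
  obtain ⟨hb, h1, h2⟩ := hab
  simp only at hb h1 h2
  have hs2 : 0 < √(2 : ℝ) := by positivity
  have h2' : √(2 : ℝ) ^ 2 = 2 := Real.sq_sqrt (by norm_num)
  have ha : 0 < a := by
    by_contra h
    nlinarith [mul_nonneg (sub_nonneg.2 (not_lt.1 h)) hs2.le]
  have hr : √(a ^ 2 + 4 * b) ^ 2 = a ^ 2 + 4 * b := Real.sq_sqrt (by positivity)
  have hr0 : 0 ≤ √(a ^ 2 + 4 * b) := Real.sqrt_nonneg _
  refine ⟨hb, ha, by positivity, by nlinarith, ?_, ?_⟩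
  · have : √(a ^ 2 + 4 * b) < 4 - a := by
      rw [Real.sqrt_lt' (by linarith)]
      nlinarith
    linarith
  · have h3 : (2 + b) ^ 2 < (a * √2) ^ 2 := by
      exact pow_lt_pow_left₀ (by linarith) (by linarith) two_ne_zero
    rw [mul_pow, h2'] at h3
    nlinarith

namespace LoziParams

variable {a b ν : ℝ} (h : LoziParams a b ν)
include h

theorem a_gt : 1.4 + 0.7 * b < a := by
  nlinarith [h.lt_sq_a, h.b_pos, h.a_pos]

theorem a_eq : a = ν - b / ν := by
  have := h.ν_pos
  field_simp
  linarith [h.sq_ν]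

theorem a_lt_ν : a < ν := by
  have := div_pos h.b_pos h.ν_pos
  linarith [h.a_eq]

theorem ν_gt : 1.4 + 1.2 * b < ν := by
  have h1 := h.a_gt
  have h2 : b / 2 ≤ b / ν := div_le_div_of_nonneg_left h.b_pos.le h.ν_pos h.ν_lt.le
  linarith [h.a_eq]

theorem b_lt : b < 1 / 2 := by
  linarith [h.ν_gt, h.ν_lt]

theorem b_lt_ν : b < ν := by linarith [h.ν_gt, h.b_lt, h.b_pos]

theorem D_pos : 0 < ν - b := sub_pos.2 h.b_lt_ν

theorem sq_ν_gt : 1.9 + 3 * b < ν ^ 2 := by nlinarith [h.ν_gt, h.b_pos]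

theorem one_add_sub : 1 + a - b = (1 + ν) * (ν - b) / ν := by
  have := h.ν_pos
  rw [h.a_eq]
  field_simp
  ring

end LoziParams

/-- The triangle `Δ` as an intersection of three half-planes. -/
def loziHalfPlanes (b ν : ℝ) : Set (ℝ × ℝ) :=
  {p | 0 ≤ b * ν / (ν - b) - b * p.1 - ν * p.2 ∧
    0 ≤ (ν ^ 2 - 2 * b) * p.2 - b * ν * (p.1 - ν / (ν - b)) ∧
    0 ≤ b * ν ^ 2 * (p.1 + ν * (ν - 1) / (ν - b)) +
      (ν ^ 2 * (2 - ν) + 2 * b * (ν - 1)) * (p.2 - b * ν / (ν - b))}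

theorem convex_loziHalfPlanes (b ν : ℝ) : Convex ℝ (loziHalfPlanes b ν) := by
  rintro p ⟨p1, p2, p3⟩ q ⟨q1, q2, q3⟩ s t hs ht hst
  have e : t = 1 - s := by linarith
  subst e
  refine ⟨?_, ?_, ?_⟩
  · have := add_nonneg (mul_nonneg hs p1) (mul_nonneg ht q1)
    simp only [Prod.fst_add, Prod.snd_add, Prod.smul_fst, Prod.smul_snd, smul_eq_mul]
    linarith
  · have := add_nonneg (mul_nonneg hs p2) (mul_nonneg ht q2)
    simp only [Prod.fst_add, Prod.snd_add, Prod.smul_fst, Prod.smul_snd, smul_eq_mul]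
    linarith
  · have := add_nonneg (mul_nonneg hs p3) (mul_nonneg ht q3)
    simp only [Prod.fst_add, Prod.snd_add, Prod.smul_fst, Prod.smul_snd, smul_eq_mul]
    linarith

namespace LoziParams

variable {a b ν : ℝ} (h : LoziParams a b ν)
include h

theorem loziMap_of_nonneg {p : ℝ × ℝ} (hp : 0 ≤ p.1) :
    loziMap a b p = (1 + p.2 - (ν - b / ν) * p.1, b * p.1) := by
  rw [loziMap, abs_of_nonneg hp, h.a_eq]

theorem loziMap_of_nonpos {p : ℝ × ℝ} (hp : p.1 ≤ 0) :
    loziMap a b p = (1 + p.2 + (ν - b / ν) * p.1, b * p.1) := by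
  rw [loziMap, abs_of_nonpos hp, h.a_eq]
  ext <;> simp

theorem loziZ_eq : loziZ a b = (ν / (ν - b), 0) := by
  have h1 := h.D_pos
  have h2 := h.ν_pos
  have h3 : √(a ^ 2 + 4 * b) = 2 * ν - a := by
    rw [Real.sqrt_eq_iff_mul_self_eq (by nlinarith [h.b_pos]) (by linarith [h.a_lt_ν])]
    linarith [h.sq_ν]
  rw [loziZ, h3, h.one_add_sub]
  ext
  · simp only
    field_simp
    ring
  · rfl

theorem loziMap_Z : loziMap a b (ν / (ν - b), 0) = (-ν * (ν - 1) / (ν - b), b * ν / (ν - b)) := by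
  have h1 := h.D_pos
  have h2 := h.ν_pos
  rw [h.loziMap_of_nonneg (by simp only; positivity)]
  ext
  · simp only
    field_simp
    ring
  · simp only
    ring

theorem loziMap_loziMap_Z : loziMap a b (-ν * (ν - 1) / (ν - b), b * ν / (ν - b)) =
    ((ν - (ν - 1) * (ν ^ 2 - 2 * b)) / (ν - b), -b * ν * (ν - 1) / (ν - b)) := by
  have h1 := h.D_pos
  have h2 := h.ν_pos
  have h3 : 0 < ν - 1 := by linarith [h.ν_gt, h.b_pos]
  rw [h.loziMap_of_nonpos (by
    simp only
    rw [neg_mul, neg_div, neg_nonpos]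
    positivity)]
  ext
  · simp only
    field_simp
    ring
  · simp only
    ring

theorem loziTriangle_eq :
    loziTriangle a b = convexHull ℝ {(ν / (ν - b), 0), (-ν * (ν - 1) / (ν - b), b * ν / (ν - b)),
      ((ν - (ν - 1) * (ν ^ 2 - 2 * b)) / (ν - b), -b * ν * (ν - 1) / (ν - b))} := by
  rw [loziTriangle, h.loziZ_eq, h.loziMap_Z, h.loziMap_loziMap_Z]

theorem loziTriangle_eq_halfPlanes :
    loziTriangle a b = loziHalfPlanes b ν := by
  have h1 := h.D_pos
  have h2 := h.ν_pos
  have h3 : 0 < ν - 1 := by linarith [h.ν_gt, h.b_pos]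
  have h4 : 0 < ν ^ 2 - b := by linarith [h.sq_ν_gt, h.b_pos]
  have h5 := h.b_pos
  rw [h.loziTriangle_eq]
  apply Subset.antisymm
  · refine convexHull_min ?_ (convex_loziHalfPlanes b ν)
    rintro p (rfl | rfl | rfl)
    · refine ⟨?_, ?_, ?_⟩
      · simp only
        field_simp
        simp
      · simp
      · have : b * ν ^ 2 * (ν / (ν - b) + ν * (ν - 1) / (ν - b)) +
          (ν ^ 2 * (2 - ν) + 2 * b * (ν - 1)) * (0 - b * ν / (ν - b)) =
          2 * b * ν * (ν - 1) * (ν ^ 2 - b) / (ν - b) := by ring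
        simp only
        rw [this]
        positivity
    · refine ⟨?_, ?_, ?_⟩
      · refine le_of_eq ?_
        simp only
        ring
      · have : (ν ^ 2 - 2 * b) * (b * ν / (ν - b)) -
            b * ν * (-ν * (ν - 1) / (ν - b) - ν / (ν - b)) =
          2 * b * ν * (ν ^ 2 - b) / (ν - b) := by ring
        simp only
        rw [this]
        positivity
      · refine le_of_eq ?_
        simp only
        ring
    · refine ⟨?_, ?_, ?_⟩
      · have : b * ν / (ν - b) - b * ((ν - (ν - 1) * (ν ^ 2 - 2 * b)) / (ν - b)) -
          ν * (-b * ν * (ν - 1) / (ν - b)) = 2 * b * (ν - 1) * (ν ^ 2 - b) / (ν - b) := by ring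
        simp only
        rw [this]
        positivity
      · refine le_of_eq ?_
        simp only
        ring
      · refine le_of_eq ?_
        simp only
        ring
  · rintro p ⟨p1, p2, p3⟩
    have hN : 0 < 2 * b * ν * (ν - 1) * (ν ^ 2 - b) / (ν - b) := by positivity
    set N := 2 * b * ν * (ν - 1) * (ν ^ 2 - b) / (ν - b) with hNdef
    set e1 := b * ν / (ν - b) - b * p.1 - ν * p.2 with he1
    set e2 := (ν ^ 2 - 2 * b) * p.2 - b * ν * (p.1 - ν / (ν - b)) with he2
    set e3 := b * ν ^ 2 * (p.1 + ν * (ν - 1) / (ν - b)) +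
      (ν ^ 2 * (2 - ν) + 2 * b * (ν - 1)) * (p.2 - b * ν / (ν - b)) with he3
    have hsum : e3 + (ν - 1) * e2 + ν * e1 = N := by
      rw [hNdef, he1, he2, he3]
      field_simp
      ring
    refine mem_convexHull_of_exists_fintype (ι := Fin 3) ![e3 / N, (ν - 1) * e2 / N, ν * e1 / N]
      ![(ν / (ν - b), 0), (-ν * (ν - 1) / (ν - b), b * ν / (ν - b)),
      ((ν - (ν - 1) * (ν ^ 2 - 2 * b)) / (ν - b), -b * ν * (ν - 1) / (ν - b))] ?_ ?_ ?_ ?_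
    · intro i
      fin_cases i
      · exact div_nonneg p3 hN.le
      · exact div_nonneg (mul_nonneg h3.le p2) hN.le
      · exact div_nonneg (mul_nonneg h2.le p1) hN.le
    · simp only [Fin.sum_univ_three, Matrix.cons_val]
      rw [← add_div, ← add_div, hsum, div_self hN.ne']
    · intro i
      fin_cases i <;> simp
    · simp only [Fin.sum_univ_three, Matrix.cons_val]
      ext
      · simp only [Prod.fst_add, Prod.smul_fst, smul_eq_mul]
        rw [div_mul_eq_mul_div, div_mul_eq_mul_div, div_mul_eq_mul_div, ← add_div, ← add_div,
          div_eq_iff hN.ne', hNdef, he1, he2, he3]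
        field_simp
        ring
      · simp only [Prod.snd_add, Prod.smul_snd, smul_eq_mul]
        rw [div_mul_eq_mul_div, div_mul_eq_mul_div, div_mul_eq_mul_div, ← add_div, ← add_div,
          div_eq_iff hN.ne', hNdef, he1, he2, he3]
        field_simp
        ring

/-- The triangle is mapped into itself. The left edge functional composed with the map is concave,
so for that edge it suffices to look at the vertices. -/
theorem mapsTo_loziMap :
    MapsTo (loziMap a b) (loziTriangle a b) (loziTriangle a b) := by
  have h1 := h.D_pos
  have h2 := h.ν_pos
  have h3 : 0 < ν - 1 := by linarith [h.ν_gt, h.b_pos]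
  have h4 : 0 < ν ^ 2 - b := by linarith [h.sq_ν_gt, h.b_pos]
  have h5 := h.b_pos
  have haν : a * ν = ν ^ 2 - b := by linarith [h.sq_ν]
  have ha0 := h.a_pos
  set c := ν / (ν - b) with hc
  have hcD : c * (ν - b) = ν := div_mul_cancel₀ _ h1.ne'
  have hleft : loziTriangle a b ⊆ {p | 0 ≤ b * ν ^ 2 * ((loziMap a b p).1 + ν * (ν - 1) / (ν - b)) +
      (ν ^ 2 * (2 - ν) + 2 * b * (ν - 1)) * ((loziMap a b p).2 - b * ν / (ν - b))} := by
    rw [h.loziTriangle_eq]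
    refine convexHull_min ?_ ?_
    · rintro p (rfl | rfl | rfl)
      · rw [mem_ofPred_eq, h.loziMap_Z]
        refine le_of_eq ?_
        simp only
        ring
      · rw [mem_ofPred_eq, h.loziMap_loziMap_Z]
        refine le_of_eq ?_
        simp only
        ring
      · -- after clearing denominators, the value at the image of the third vertex factors
        rw [mem_ofPred_eq]
        rcases le_total 0 (ν - (ν - 1) * (ν ^ 2 - 2 * b)) with hx | hx
        · rw [h.loziMap_of_nonneg (by simp only; positivity)]
          have : b * ν ^ 2 * (1 + -b * ν * (ν - 1) / (ν - b) -
              (ν - b / ν) * ((ν - (ν - 1) * (ν ^ 2 - 2 * b)) / (ν - b)) + ν * (ν - 1) / (ν - b)) +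
              (ν ^ 2 * (2 - ν) + 2 * b * (ν - 1)) *
              (b * ((ν - (ν - 1) * (ν ^ 2 - 2 * b)) / (ν - b)) - b * ν / (ν - b)) =
              b * (ν ^ 2 * (ν - 1) + (ν - 1) * (ν ^ 2 - 2 * b)) *
              ((ν - 1) * (ν ^ 2 - 2 * b) - b * ν) / (ν - b) := by
            field_simp
            ring
          simp only
          rw [this]
          have k1 : 0 ≤ (ν - 1) * (ν ^ 2 - 2 * b) := by
            have : 0 < ν ^ 2 - 2 * b := by linarith [h.sq_ν_gt]
            positivity
          have k2 : 0 ≤ (ν - 1) * (ν ^ 2 - 2 * b) - b * ν := by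
            nlinarith [h.sq_ν_gt, h.ν_gt, h.ν_lt, mul_pos h5 (sub_pos.2 h.ν_lt)]
          positivity
        · rw [h.loziMap_of_nonpos (by simp only; exact div_nonpos_of_nonpos_of_nonneg hx h1.le)]
          have : b * ν ^ 2 * (1 + -b * ν * (ν - 1) / (ν - b) +
              (ν - b / ν) * ((ν - (ν - 1) * (ν ^ 2 - 2 * b)) / (ν - b)) + ν * (ν - 1) / (ν - b)) +
              (ν ^ 2 * (2 - ν) + 2 * b * (ν - 1)) *
              (b * ((ν - (ν - 1) * (ν ^ 2 - 2 * b)) / (ν - b)) - b * ν / (ν - b)) =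
              b * ((2 - ν) * (ν ^ 2 + ν - b) * (2 * ν + 2 * b * (ν - 1)) +
              2 * ν * (2 - ν) * (-(ν - (ν - 1) * (ν ^ 2 - 2 * b)))) / (ν - b) := by
            field_simp
            ring
          simp only
          rw [this]
          have k1 : 0 < 2 - ν := sub_pos.2 h.ν_lt
          have k2 : 0 < ν ^ 2 + ν - b := by linarith
          have k3 := neg_nonneg.2 hx
          positivity
    · rintro p hp q hq s t hs ht hst
      simp only [mem_ofPred_eq, loziMap] at hp hq ⊢
      simp only [Prod.fst_add, Prod.snd_add, Prod.smul_fst, Prod.smul_snd, smul_eq_mul]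
      have habs : |s * p.1 + t * q.1| ≤ s * |p.1| + t * |q.1| := by
        refine (abs_add_le _ _).trans ?_
        rw [abs_mul, abs_mul, abs_of_nonneg hs, abs_of_nonneg ht]
      have k := mul_nonneg (by positivity : 0 ≤ b * ν ^ 2 * a) (sub_nonneg.2 habs)
      have k2 := add_nonneg (mul_nonneg hs hp) (mul_nonneg ht hq)
      have e : t = 1 - s := by linarith
      subst e
      linarith
  intro p hp
  have h6 := hleft hp
  rw [h.loziTriangle_eq_halfPlanes] at hp ⊢
  obtain ⟨p1, p2, p3⟩ := hp
  refine ⟨?_, ?_, h6⟩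
  · have : ν * (b * ν / (ν - b) - b * (loziMap a b p).1 - ν * (loziMap a b p).2) =
        b * (b * ν / (ν - b) - b * p.1 - ν * p.2) + b * (a * ν) * (|p.1| - p.1) := by
      rw [haν]
      simp only [loziMap]
      have : a = (ν ^ 2 - b) / ν := by rw [← haν]; field_simp
      rw [this]
      field_simp
      ring
    have h7 : 0 ≤ |p.1| - p.1 := sub_nonneg.2 (le_abs_self _)
    refine (mul_nonneg_iff_of_pos_left h2).1 ?_
    rw [this]
    positivity
  · have : (ν ^ 2 - 2 * b) * (loziMap a b p).2 - b * ν * ((loziMap a b p).1 - ν / (ν - b)) =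
        b * (b * ν / (ν - b) - b * p.1 - ν * p.2) + b * (a * ν) * (|p.1| + p.1) := by
      rw [haν]
      simp only [loziMap]
      have : a = (ν ^ 2 - b) / ν := by rw [← haν]; field_simp
      rw [this]
      field_simp
      ring
    have h7 : 0 ≤ |p.1| + p.1 := by linarith [neg_abs_le p.1]
    rw [this]
    positivity

end LoziParams

/-! ### The stable manifold of the fixed point -/

/-- The linear functional whose zero line contains the local stable manifold of the fixed point
`X`. -/
noncomputable def loziLine (ν : ℝ) (p : ℝ × ℝ) : ℝ := ν * p.1 - p.2 - ν / (1 + ν)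

theorem continuous_loziLine (ν : ℝ) : Continuous (loziLine ν) := by
  unfold loziLine; fun_prop

theorem continuous_loziMap (a b : ℝ) : Continuous (loziMap a b) := by
  unfold loziMap; fun_prop

theorem isCompact_loziTriangle (a b : ℝ) : IsCompact (loziTriangle a b) :=
  (toFinite _).isCompact_convexHull ℝ

theorem convex_loziTriangle (a b : ℝ) : Convex ℝ (loziTriangle a b) := convex_convexHull ℝ _

theorem isClosed_loziTriangle (a b : ℝ) : IsClosed (loziTriangle a b) :=
  (isCompact_loziTriangle a b).isClosed

theorem iterate_mem_loziStable {a b : ℝ} {p : ℝ × ℝ} (n : ℕ) :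
    (loziMap a b)^[n] p ∈ loziStable a b ↔ p ∈ loziStable a b := by
  simp only [loziStable, mem_ofPred_eq, ← Function.iterate_add_apply]
  exact tendsto_add_atTop_iff_nat (f := fun k => (loziMap a b)^[k] p) n

namespace LoziParams

variable {a b ν : ℝ} (h : LoziParams a b ν)
include h

theorem iterate_mem {p : ℝ × ℝ} (hp : p ∈ loziTriangle a b) (n : ℕ) :
    (loziMap a b)^[n] p ∈ loziTriangle a b :=
  h.mapsTo_loziMap.iterate n hp

theorem loziLine_loziMap {p : ℝ × ℝ} (hp : 0 ≤ p.1) :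
    loziLine ν (loziMap a b p) = -ν * loziLine ν p := by
  have h2 := h.ν_pos
  rw [h.loziMap_of_nonneg hp]
  simp only [loziLine]
  field_simp
  ring

theorem loziLine_neg {p : ℝ × ℝ} (hp : p ∈ loziTriangle a b) (hx : p.1 ≤ 0) :
    loziLine ν p < 0 := by
  have h1 := h.D_pos
  have h2 := h.ν_pos
  have h5 := h.b_pos
  have hs : 0 < ν ^ 2 - 2 * b := by linarith [h.sq_ν_gt]
  rw [h.loziTriangle_eq_halfPlanes] at hp
  obtain ⟨-, p2, -⟩ := hp
  have key : b * ν * (ν / (ν - b)) < (ν ^ 2 - 2 * b) * (ν / (1 + ν)) := by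
    rw [← mul_div_assoc, ← mul_div_assoc, div_lt_div_iff₀ h1 (by linarith)]
    have k1 : 3 * b < ν * (ν - 2 * b) := by nlinarith [h.ν_gt, h.b_lt]
    have k2 : b * ν * (1 + ν) < (ν ^ 2 - 2 * b) * (ν - b) := by nlinarith
    nlinarith
  have : (ν ^ 2 - 2 * b) * loziLine ν p < 0 := by
    have k3 : 0 ≤ (ν ^ 2 - 3 * b) * ν * (-p.1) := by
      have : 0 < ν ^ 2 - 3 * b := by linarith [h.sq_ν_gt]
      have : 0 ≤ -p.1 := by linarith
      positivity
    simp only [loziLine]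
    nlinarith
  exact (pos_iff_neg_of_mul_neg this).1 hs

theorem fst_pos {p : ℝ × ℝ} (hp : p ∈ loziTriangle a b) (hx : 0 ≤ loziLine ν p) : 0 < p.1 := by
  by_contra hc
  exact absurd (h.loziLine_neg hp (not_lt.1 hc)) (not_lt.2 hx)

theorem loziLine_loziMap_pos {p : ℝ × ℝ} (hp : p ∈ loziTriangle a b) (hx : p.1 = 0) :
    0 < loziLine ν (loziMap a b p) := by
  rw [h.loziLine_loziMap hx.ge]
  nlinarith [h.loziLine_neg hp hx.le, h.ν_pos]

theorem loziX_eq : loziX a b = (ν / ((1 + ν) * (ν - b)), b * (ν / ((1 + ν) * (ν - b)))) := by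
  have h1 := h.D_pos
  have h2 := h.ν_pos
  rw [loziX, h.one_add_sub]
  ext
  · simp
  · simp only
    field_simp

theorem loziLine_loziX : loziLine ν (loziX a b) = 0 := by
  have h1 := h.D_pos
  have h2 := h.ν_pos
  rw [h.loziX_eq]
  simp only [loziLine]
  field_simp
  ring

theorem loziX_fst_pos : 0 < (loziX a b).1 := by
  have h1 := h.D_pos
  have h2 := h.ν_pos
  rw [h.loziX_eq]
  positivity

theorem loziLine_iterate_eq_zero {p : ℝ × ℝ} (hp : p ∈ loziTriangle a b) {m n : ℕ} (hmn : m ≤ n)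
    (hm : loziLine ν ((loziMap a b)^[m] p) = 0) : loziLine ν ((loziMap a b)^[n] p) = 0 := by
  induction n, hmn using Nat.le_induction with
  | base => exact hm
  | succ n _ ih =>
    rw [Function.iterate_succ_apply', h.loziLine_loziMap (h.fst_pos (h.iterate_mem hp n) ih.ge).le,
      ih, mul_zero]

theorem iterate_fst_pos {p : ℝ × ℝ} (hp : p ∈ loziTriangle a b) {m n : ℕ} (hmn : m ≤ n)
    (hm : loziLine ν ((loziMap a b)^[m] p) = 0) : 0 < ((loziMap a b)^[n] p).1 :=
  h.fst_pos (h.iterate_mem hp n) (h.loziLine_iterate_eq_zero hp hmn hm).ge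

theorem mem_loziStable_of_loziLine {p : ℝ × ℝ} (hp : p ∈ loziTriangle a b)
    (hl : loziLine ν p = 0) : p ∈ loziStable a b := by
  have h1 := h.D_pos
  have h2 := h.ν_pos
  have h0 : ∀ n, loziLine ν ((loziMap a b)^[n] p) = 0 := fun n =>
    h.loziLine_iterate_eq_zero hp (Nat.zero_le n) hl
  have hx : ∀ n, ((loziMap a b)^[n] p).1 - (loziX a b).1 =
      (p.1 - (loziX a b).1) * (b / ν) ^ n := by
    intro n
    induction n with
    | zero => simp
    | succ n ih =>
      have hl' := h0 n
      have hpos := h.iterate_fst_pos hp (Nat.zero_le n) hl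
      rw [pow_succ, ← mul_assoc, ← ih, Function.iterate_succ_apply',
        h.loziMap_of_nonneg hpos.le, h.loziX_eq]
      simp only [loziLine] at hl' ⊢
      have : ((loziMap a b)^[n] p).2 = ν * ((loziMap a b)^[n] p).1 - ν / (1 + ν) := by linarith
      rw [this]
      field_simp
      ring
  have hlim : Tendsto (fun n => ((loziMap a b)^[n] p).1) atTop (𝓝 (loziX a b).1) := by
    have h3 : Tendsto (fun n : ℕ => (loziX a b).1 + (p.1 - (loziX a b).1) * (b / ν) ^ n) atTop
        (𝓝 ((loziX a b).1 + (p.1 - (loziX a b).1) * 0)) :=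
      ((tendsto_pow_atTop_nhds_zero_of_lt_one (div_nonneg h.b_pos.le h2.le)
        ((div_lt_one h2).2 h.b_lt_ν)).const_mul _).const_add _
    rw [mul_zero, add_zero] at h3
    refine h3.congr fun n => ?_
    rw [← hx n]
    ring
  have hy : ∀ n, ((loziMap a b)^[n] p).2 = ν * ((loziMap a b)^[n] p).1 - ν / (1 + ν) := fun n => by
    have := h0 n
    simp only [loziLine] at this
    linarith
  have hX : (loziX a b).2 = ν * (loziX a b).1 - ν / (1 + ν) := by
    have := h.loziLine_loziX
    simp only [loziLine] at this
    linarith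
  rw [loziStable, mem_ofPred_eq, nhds_prod_eq, tendsto_prod_iff']
  refine ⟨hlim, ?_⟩
  rw [hX]
  exact ((hlim.const_mul ν).sub_const _).congr fun n => (hy n).symm

/-- On the stable manifold the orbit reaches the stable line: near `X` the distance to this line
is multiplied by `ν > 1`. -/
theorem exists_loziLine_iterate_eq_zero {p : ℝ × ℝ} (hp : p ∈ loziStable a b) :
    ∃ n, loziLine ν ((loziMap a b)^[n] p) = 0 := by
  have hlim : Tendsto (fun n : ℕ => (loziMap a b)^[n] p) atTop (𝓝 (loziX a b)) := hp
  have hev : ∀ᶠ n : ℕ in atTop, 0 < ((loziMap a b)^[n] p).1 :=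
    ((continuous_fst.tendsto _).comp hlim).eventually (lt_mem_nhds h.loziX_fst_pos)
  obtain ⟨N, hN⟩ := eventually_atTop.1 hev
  refine ⟨N, ?_⟩
  by_contra hne
  have hgrow : ∀ n, |loziLine ν ((loziMap a b)^[N] p)| ≤
      |loziLine ν ((loziMap a b)^[N + n] p)| := by
    intro n
    induction n with
    | zero => exact le_rfl
    | succ n ih =>
      rw [← add_assoc, Function.iterate_succ_apply', h.loziLine_loziMap (hN _ (by omega)).le,
        abs_mul, abs_neg, abs_of_pos h.ν_pos]
      have : 1 < ν := by linarith [h.ν_gt, h.b_pos]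
      nlinarith [abs_nonneg (loziLine ν ((loziMap a b)^[N + n] p))]
  have hlim2 : Tendsto (fun n : ℕ => |loziLine ν ((loziMap a b)^[N + n] p)|) atTop (𝓝 0) := by
    have h3 := (((continuous_loziLine ν).tendsto _).comp hlim).abs
    rw [h.loziLine_loziX, abs_zero] at h3
    exact h3.comp (tendsto_add_atTop_nat N) |>.congr fun n => by simp [add_comm]
  exact absurd (ge_of_tendsto' hlim2 hgrow) (not_le.2 (abs_pos.2 hne))

end LoziParams

/-- The points of the triangle that reach the stable line after exactly `n` steps. The condition
on the first coordinate says that the line is not reached earlier: on the line the first coordinate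
is positive, and from a point with positive first coordinate that is not on the line it is not
reached in the next step. In this form the set is closed. -/
def stablePiece (a b ν : ℝ) : ℕ → Set (ℝ × ℝ)
  | 0 => {p ∈ loziTriangle a b | loziLine ν p = 0}
  | n + 1 => {p ∈ loziTriangle a b | loziLine ν ((loziMap a b)^[n + 1] p) = 0 ∧
      ((loziMap a b)^[n] p).1 ≤ 0}

theorem stablePiece_subset (a b ν : ℝ) (n : ℕ) : stablePiece a b ν n ⊆ loziTriangle a b := by
  cases n <;> exact fun p hp => hp.1

theorem isClosed_stablePiece (a b ν : ℝ) (n : ℕ) : IsClosed (stablePiece a b ν n) := by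
  have hL := continuous_loziMap a b
  have hl := continuous_loziLine ν
  cases n with
  | zero => exact (isClosed_loziTriangle a b).inter (isClosed_eq hl continuous_const)
  | succ n =>
    exact (isClosed_loziTriangle a b).inter
      ((isClosed_eq (hl.comp (hL.iterate (n + 1))) continuous_const).inter
        (isClosed_le (continuous_fst.comp (hL.iterate n)) continuous_const))

theorem loziLine_of_mem_stablePiece {a b ν : ℝ} {n : ℕ} {p : ℝ × ℝ} (hp : p ∈ stablePiece a b ν n) :
    loziLine ν ((loziMap a b)^[n] p) = 0 := by
  cases n with
  | zero => exact hp.2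
  | succ n => exact hp.2.1

namespace LoziParams

variable {a b ν : ℝ} (h : LoziParams a b ν)
include h

theorem disjoint_stablePiece {m n : ℕ} (hmn : m ≠ n) :
    Disjoint (stablePiece a b ν m) (stablePiece a b ν n) := by
  wlog hlt : m < n generalizing m n
  · exact (this hmn.symm (lt_of_le_of_ne (not_lt.1 hlt) hmn.symm)).symm
  rw [disjoint_left]
  intro p hpm hpn
  obtain ⟨k, rfl⟩ := Nat.exists_eq_succ_of_ne_zero (by omega : n ≠ 0)
  exact absurd (h.iterate_fst_pos (stablePiece_subset _ _ _ _ hpm) (by omega : m ≤ k)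
    (loziLine_of_mem_stablePiece hpm)) (not_lt.2 hpn.2.2)

theorem iUnion_stablePiece : ⋃ n, stablePiece a b ν n = loziTriangle a b ∩ loziStable a b := by
  ext p
  rw [mem_iUnion]
  constructor
  · rintro ⟨n, hn⟩
    have hp := stablePiece_subset _ _ _ _ hn
    exact ⟨hp, (iterate_mem_loziStable n).1
      (h.mem_loziStable_of_loziLine (h.iterate_mem hp n) (loziLine_of_mem_stablePiece hn))⟩
  · rintro ⟨hp, hs⟩
    have hex := h.exists_loziLine_iterate_eq_zero hs
    classical
    refine ⟨Nat.find hex, ?_⟩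
    have h1 := Nat.find_spec hex
    have h2 : ∀ m < Nat.find hex, _ := fun m hm => Nat.find_min hex hm
    rcases hn : Nat.find hex with _ | n
    · rw [hn] at h1
      exact ⟨hp, h1⟩
    · rw [hn] at h1 h2
      refine ⟨hp, h1, ?_⟩
      by_contra hpos
      refine h2 n (by omega) ?_
      rw [Function.iterate_succ_apply', h.loziLine_loziMap (not_le.1 hpos).le] at h1
      exact (mul_eq_zero.1 h1).resolve_left (neg_ne_zero.2 h.ν_pos.ne')

end LoziParams

/-- A union of countably many convex sets. -/
def IsCountableUnionConvex (S : Set (ℝ × ℝ)) : Prop :=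
  ∃ 𝒞 : Set (Set (ℝ × ℝ)), 𝒞.Countable ∧ (∀ C ∈ 𝒞, Convex ℝ C) ∧ ⋃₀ 𝒞 = S

theorem Convex.isCountableUnionConvex {S : Set (ℝ × ℝ)} (hS : Convex ℝ S) :
    IsCountableUnionConvex S := ⟨{S}, countable_singleton S, by simpa using hS, by simp⟩

theorem IsCountableUnionConvex.inter_convex {S C : Set (ℝ × ℝ)} (hS : IsCountableUnionConvex S)
    (hC : Convex ℝ C) : IsCountableUnionConvex (C ∩ S) := by
  obtain ⟨𝒞, h1, h2, rfl⟩ := hS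
  refine ⟨(fun B => C ∩ B) '' 𝒞, h1.image _, ?_, ?_⟩
  · rintro _ ⟨B, hB, rfl⟩
    exact hC.inter (h2 B hB)
  · rw [sUnion_image, sUnion_eq_biUnion, inter_iUnion₂]

theorem convex_preimage_loziMap {C : Set (ℝ × ℝ)} (hC : Convex ℝ C) (a b : ℝ) :
    Convex ℝ ({p | 0 ≤ p.1} ∩ loziMap a b ⁻¹' C) ∧
      Convex ℝ ({p | p.1 ≤ 0} ∩ loziMap a b ⁻¹' C) := by
  constructor
  · rintro p ⟨hp, hpC⟩ q ⟨hq, hqC⟩ s t hs ht hst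
    have hp' : 0 ≤ p.1 := hp
    have hq' : 0 ≤ q.1 := hq
    have hx : 0 ≤ s * p.1 + t * q.1 := by positivity
    refine ⟨hx, ?_⟩
    have e : loziMap a b (s • p + t • q) = s • loziMap a b p + t • loziMap a b q := by
      obtain rfl : t = 1 - s := by linarith
      simp only [loziMap]
      ext
      · simp only [Prod.fst_add, Prod.snd_add, Prod.smul_fst, Prod.smul_snd, smul_eq_mul]
        rw [abs_of_nonneg hx, abs_of_nonneg hp', abs_of_nonneg hq']
        ring
      · simp only [Prod.fst_add, Prod.snd_add, Prod.smul_fst, Prod.smul_snd, smul_eq_mul]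
        ring
    rw [mem_preimage, e]
    exact hC hpC hqC hs ht hst
  · rintro p ⟨hp, hpC⟩ q ⟨hq, hqC⟩ s t hs ht hst
    have hp' : p.1 ≤ 0 := hp
    have hq' : q.1 ≤ 0 := hq
    have hx : s * p.1 + t * q.1 ≤ 0 := by nlinarith
    refine ⟨hx, ?_⟩
    have e : loziMap a b (s • p + t • q) = s • loziMap a b p + t • loziMap a b q := by
      obtain rfl : t = 1 - s := by linarith
      simp only [loziMap]
      ext
      · simp only [Prod.fst_add, Prod.snd_add, Prod.smul_fst, Prod.smul_snd, smul_eq_mul]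
        rw [abs_of_nonpos hx, abs_of_nonpos hp', abs_of_nonpos hq']
        ring
      · simp only [Prod.fst_add, Prod.snd_add, Prod.smul_fst, Prod.smul_snd, smul_eq_mul]
        ring
    rw [mem_preimage, e]
    exact hC hpC hqC hs ht hst

theorem IsCountableUnionConvex.preimage_loziMap {S : Set (ℝ × ℝ)} (hS : IsCountableUnionConvex S)
    (a b : ℝ) : IsCountableUnionConvex (loziMap a b ⁻¹' S) := by
  obtain ⟨𝒞, h1, h2, rfl⟩ := hS
  refine ⟨(fun C => {p | 0 ≤ p.1} ∩ loziMap a b ⁻¹' C) '' 𝒞 ∪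
    (fun C => {p | p.1 ≤ 0} ∩ loziMap a b ⁻¹' C) '' 𝒞, (h1.image _).union (h1.image _), ?_, ?_⟩
  · rintro _ (⟨C, hC, rfl⟩ | ⟨C, hC, rfl⟩)
    · exact (convex_preimage_loziMap (h2 C hC) a b).1
    · exact (convex_preimage_loziMap (h2 C hC) a b).2
  · rw [sUnion_union, sUnion_image, sUnion_image, sUnion_eq_biUnion, preimage_iUnion₂,
      ← inter_iUnion₂, ← inter_iUnion₂, ← union_inter_distrib_right]
    convert univ_inter _
    rw [eq_univ_iff_forall]
    exact fun p => le_total 0 p.1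

theorem convex_setOf_loziLine_eq_zero (ν : ℝ) : Convex ℝ {p | loziLine ν p = 0} := by
  intro p hp q hq s t hs ht hst
  obtain rfl : t = 1 - s := by linarith
  simp only [loziLine, mem_ofPred_eq] at hp hq ⊢
  simp only [Prod.fst_add, Prod.snd_add, Prod.smul_fst, Prod.smul_snd, smul_eq_mul]
  linear_combination s * hp + (1 - s) * hq

theorem isCountableUnionConvex_stablePiece (a b ν : ℝ) (n : ℕ) :
    IsCountableUnionConvex (stablePiece a b ν n) := by
  cases n with
  | zero =>
    exact ((convex_loziTriangle a b).inter (convex_setOf_loziLine_eq_zero ν)).isCountableUnionConvex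
  | succ n =>
    have hS : IsCountableUnionConvex ({p | p.1 ≤ 0} ∩ loziMap a b ⁻¹' {p | loziLine ν p = 0}) :=
      (convex_preimage_loziMap (convex_setOf_loziLine_eq_zero ν) a b).2.isCountableUnionConvex
    have hS' : ∀ m, IsCountableUnionConvex ((loziMap a b)^[m] ⁻¹'
        ({p | p.1 ≤ 0} ∩ loziMap a b ⁻¹' {p | loziLine ν p = 0})) := by
      intro m
      induction m with
      | zero => exact hS
      | succ m ih =>
        rw [Function.iterate_succ, preimage_comp]
        exact ih.preimage_loziMap a b
    convert (hS' n).inter_convex (convex_loziTriangle a b) using 1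
    ext p
    simp only [stablePiece, mem_ofPred_eq, mem_inter_iff, mem_preimage,
      Function.iterate_succ_apply']
    tauto

/-! ### Contraction of continua that never cross the stable line -/

/-- A bounded sequence that expands, in one or in two steps, whenever it does not decay
geometrically, must decay geometrically. The rate `θ = 9 / 10` is close enough to `1` for
`1 < a - b / θ` and `1 < G - b ^ 2 / θ ^ 2` to hold in the Misiurewicz set. -/
theorem geometric_decay_of_expansion {w : ℕ → ℝ} {M a b G : ℝ} (hw0 : ∀ i, 0 ≤ w i)
    (hwM : ∀ i, w i ≤ M) (hb : 0 ≤ b) (ha : 1 < a - 10 / 9 * b) (hG : 1 < G - 100 / 81 * b ^ 2)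
    (hrec : ∀ i, a * w (i + 2) - b * w (i + 1) ≤ w (i + 3) ∨
      (G * w (i + 2) - b ^ 2 * w i ≤ w (i + 4) ∧ a * w (i + 3) - b * w (i + 2) ≤ w (i + 4))) :
    ∀ i, w i ≤ 10 / 9 * M * (9 / 10) ^ i := by
  obtain ⟨g, hg1, hg⟩ := exists_between (lt_min ha hG)
  have hga := hg.trans_le (min_le_left _ _)
  have hgG := hg.trans_le (min_le_right _ _)
  -- `P i` says that the decay fails at the index `i + 2`; it propagates with growth factor `g`
  let P : ℕ → Prop := fun i =>
    0 < w (i + 2) ∧ 9 / 10 * w (i + 1) ≤ w (i + 2) ∧ 81 / 100 * w i ≤ w (i + 2)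
  have step : ∀ i, P i → ∃ j, P j ∧ g * w (i + 2) ≤ w (j + 2) := by
    rintro i ⟨h0, h1, h2⟩
    rcases hrec i with h | ⟨h, h'⟩
    · have k1 : g * w (i + 2) ≤ w (i + 3) := by
        nlinarith [mul_le_mul_of_nonneg_left h1 hb, mul_le_mul_of_nonneg_right hga.le h0.le]
      exact ⟨i + 1, ⟨by nlinarith, by nlinarith, by nlinarith⟩, k1⟩
    · have k1 : g * w (i + 2) ≤ w (i + 4) := by
        nlinarith [mul_le_mul_of_nonneg_left h2 (sq_nonneg b),
          mul_le_mul_of_nonneg_right hgG.le h0.le]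
      refine ⟨i + 2, ⟨by nlinarith, ?_, by nlinarith⟩, k1⟩
      have k2 : w (i + 2) ≤ w (i + 4) := by nlinarith
      have k3 : a * w (i + 3) ≤ (1 + b) * w (i + 4) := by nlinarith
      have k4 : (1 + b) * w (i + 3) ≤ a * w (i + 3) :=
        mul_le_mul_of_nonneg_right (by linarith) (hw0 _)
      have k5 : w (i + 3) ≤ w (i + 4) := le_of_mul_le_mul_left (k4.trans k3) (by linarith)
      show 9 / 10 * w (i + 3) ≤ w (i + 4)
      linarith [hw0 (i + 3)]
  have hnot : ∀ i, ¬ P i := by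
    intro i hi
    have hpow : ∀ k : ℕ, ∃ j, P j ∧ g ^ k * w (i + 2) ≤ w (j + 2) := by
      intro k
      induction k with
      | zero => exact ⟨i, hi, by simp⟩
      | succ k ih =>
        obtain ⟨j, hj, hk⟩ := ih
        obtain ⟨j', hj', hk'⟩ := step j hj
        refine ⟨j', hj', le_trans ?_ hk'⟩
        rw [pow_succ', mul_assoc]
        exact mul_le_mul_of_nonneg_left hk (by linarith)
    obtain ⟨k, hk⟩ := pow_unbounded_of_one_lt (M / w (i + 2)) hg1
    obtain ⟨j, -, hj⟩ := hpow k
    rw [div_lt_iff₀ hi.1] at hk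
    linarith [hwM (j + 2)]
  have main : ∀ i, w i ≤ 10 / 9 * M * (9 / 10) ^ i ∧
      w (i + 1) ≤ 10 / 9 * M * (9 / 10) ^ (i + 1) := by
    intro i
    induction i with
    | zero => constructor <;> norm_num <;> linarith [hwM 0, hwM 1, hw0 0]
    | succ i ih =>
      refine ⟨ih.2, ?_⟩
      have hM : 0 ≤ M := (hw0 0).trans (hwM 0)
      have hp : 0 ≤ 10 / 9 * M * (9 / 10 : ℝ) ^ (i + 2) := by positivity
      by_contra hlt
      have hlt := not_le.1 hlt
      refine hnot i ⟨by linarith, ?_, ?_⟩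
      · have := ih.2
        rw [show i + 1 + 1 = (i + 1) + 1 from rfl, pow_succ _ (i + 1)] at hlt
        linarith
      · have := ih.1
        rw [show i + 1 + 1 = i + 2 from rfl, pow_add] at hlt
        linarith
  exact fun i => (main i).1

/-- Continuous functions on a connected set satisfying the Lozi recursion, such that a zero of one
of them forces the next one to be positive, become constant at a geometric rate. -/
theorem geometric_decay_of_loziRecursion {X : Type*} [TopologicalSpace X] {K : Set X}
    (hK : IsPreconnected K) {u : ℕ → X → ℝ} (hu : ∀ i, ContinuousOn (u i) K) {a b M : ℝ}
    (ha : 0 < a) (hb : 0 ≤ b) (hab : 1 < a - 10 / 9 * b) (h2b : 2 * b < a ^ 2)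
    (hG : 1 < a ^ 2 / 2 - 2 * b ^ 2 / a ^ 2 - 100 / 81 * b ^ 2) (hM : 0 ≤ M)
    (hrec : ∀ i, ∀ p ∈ K, u (i + 2) p = 1 + b * u i p - a * |u (i + 1) p|)
    (hcross : ∀ i, ∀ c ∈ K, u i c = 0 → ∀ p ∈ K, 0 < u (i + 1) p)
    (hbound : ∀ i, ∀ p ∈ K, ∀ q ∈ K, |u i p - u i q| ≤ M) (i : ℕ) {p q : X} (hp : p ∈ K)
    (hq : q ∈ K) : |u i p - u i q| ≤ 10 / 9 * M * (9 / 10) ^ i := by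
  let w : ℕ → ℝ := fun i => Metric.diam (u i '' K)
  have hbdd : ∀ i, Bornology.IsBounded (u i '' K) := fun i => Metric.isBounded_iff.2 ⟨M, by
    rintro _ ⟨p, hp, rfl⟩ _ ⟨q, hq, rfl⟩
    exact hbound i p hp q hq⟩
  have hle : ∀ i, ∀ p ∈ K, ∀ q ∈ K, |u i p - u i q| ≤ w i := fun i p hp q hq =>
    Metric.dist_le_diam_of_mem (hbdd i) (mem_image_of_mem _ hp) (mem_image_of_mem _ hq)
  have hge : ∀ i C, 0 ≤ C → (∀ p ∈ K, ∀ q ∈ K, u i p - u i q ≤ C) → w i ≤ C := by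
    intro i C hC h
    refine Metric.diam_le_of_forall_dist_le hC ?_
    rintro _ ⟨p, hp, rfl⟩ _ ⟨q, hq, rfl⟩
    rw [Real.dist_eq, abs_le]
    constructor <;> linarith [h p hp q hq, h q hq p hp]
  have hw0 : ∀ i, 0 ≤ w i := fun i => Metric.diam_nonneg
  have hsign : ∀ i, (∃ c ∈ K, u i c = 0) ∨ (∀ p ∈ K, 0 ≤ u i p) ∨ (∀ p ∈ K, u i p ≤ 0) := by
    intro i
    by_contra! hcon
    obtain ⟨h1, ⟨p, hp, hp0⟩, ⟨q, hq, hq0⟩⟩ := hcon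
    obtain ⟨c, hc, hc0⟩ := hK.intermediate_value hp hq (hu i) ⟨hp0.le, hq0.le⟩
    exact h1 c hc hc0
  -- no fold: expansion in one step
  have hstep : ∀ i, ((∀ p ∈ K, 0 ≤ u (i + 1) p) ∨ (∀ p ∈ K, u (i + 1) p ≤ 0)) →
      a * w (i + 1) - b * w i ≤ w (i + 2) := by
    intro i hs
    suffices w (i + 1) ≤ (w (i + 2) + b * w i) / a by
      rw [le_div_iff₀ ha] at this
      linarith
    refine hge _ _ (div_nonneg (add_nonneg (hw0 _) (mul_nonneg hb (hw0 _))) ha.le) ?_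
    intro p hp q hq
    rw [le_div_iff₀ ha]
    have h1 := abs_le.1 (hle (i + 2) p hp q hq)
    have h2 := abs_le.1 (hle i p hp q hq)
    have h3 := mul_le_mul_of_nonneg_left h2.1 hb
    have h4 := mul_le_mul_of_nonneg_left h2.2 hb
    rw [hrec i p hp, hrec i q hq] at h1
    rcases hs with hs | hs
    · rw [abs_of_nonneg (hs p hp), abs_of_nonneg (hs q hq)] at h1
      linarith [h1.1]
    · rw [abs_of_nonpos (hs p hp), abs_of_nonpos (hs q hq)] at h1
      linarith [h1.2]
  have hmain := geometric_decay_of_expansion (w := w) (M := M) hw0 (fun i => hge _ _ hM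
    fun p hp q hq => (le_abs_self _).trans (hbound i p hp q hq)) hb hab hG ?_
  · exact (hle i p hp q hq).trans (hmain i)
  intro i
  rcases hsign (i + 2) with ⟨c, hc, hc0⟩ | hs
  swap
  · exact Or.inl (hstep (i + 1) hs)
  have hpos : ∀ p ∈ K, 0 < u (i + 3) p := hcross (i + 2) c hc hc0
  refine Or.inr ⟨?_, hstep (i + 2) (Or.inl fun p hp => (hpos p hp).le)⟩
  have hs := (hsign (i + 1)).resolve_left fun ⟨d, hd, hd0⟩ =>
    (hcross (i + 1) d hd hd0 c hc).ne' hc0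
  set W := w (i + 4) + b ^ 2 * w i with hW
  have hW0 : 0 ≤ W := add_nonneg (hw0 _) (mul_nonneg (sq_nonneg b) (hw0 _))
  -- displacement of `p` relative to the fold point `c` after two steps
  have hdisp : ∃ s : ℝ, (s = 1 ∨ s = -1) ∧ ∀ p ∈ K,
      a ^ 2 * |u (i + 2) p| + b * u (i + 2) p + s * b * u (i + 2) p ≤ W := by
    suffices ∃ s : ℝ, (s = 1 ∨ s = -1) ∧ ∀ p ∈ K, |u (i + 1) p| = s * u (i + 1) p by
      obtain ⟨s, hs1, hs⟩ := this
      refine ⟨s, hs1, fun p hp => ?_⟩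
      have e1 := hrec i p hp
      have e1' := hrec i c hc
      have e2 := hrec (i + 1) p hp
      have e2' := hrec (i + 1) c hc
      have e3 := hrec (i + 2) p hp
      have e3' := hrec (i + 2) c hc
      rw [show i + 1 + 1 = i + 2 from rfl, show i + 1 + 2 = i + 3 from rfl] at e2 e2'
      rw [show i + 2 + 1 = i + 3 from rfl, show i + 2 + 2 = i + 4 from rfl] at e3 e3'
      rw [hc0] at e1' e2' e3'
      rw [abs_zero] at e2'
      rw [abs_of_pos (hpos p hp)] at e3
      rw [abs_of_pos (hpos c hc)] at e3'
      have h1 := (abs_le.1 (hle (i + 4) p hp c hc)).2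
      have h2 := abs_le.1 (hle i p hp c hc)
      have h3 := mul_le_mul_of_nonneg_left h2.1 (sq_nonneg b)
      have h4 := mul_le_mul_of_nonneg_left h2.2 (sq_nonneg b)
      have e4 : u (i + 4) p - u (i + 4) c = b * u (i + 2) p + a ^ 2 * |u (i + 2) p| -
          b * (a * (u (i + 1) p - u (i + 1) c)) := by
        rw [e3, e3', e2, e2']; ring
      rw [hs p hp] at e1
      rw [hs c hc] at e1'
      have e5 : a * (u (i + 1) p - u (i + 1) c) = s * (b * (u i p - u i c) - u (i + 2) p) := by
        rcases hs1 with rfl | rfl <;> linarith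
      rw [e5] at e4
      rcases hs1 with rfl | rfl <;> linarith
    rcases hs with hs | hs
    · exact ⟨1, Or.inl rfl, fun p hp => by rw [abs_of_nonneg (hs p hp), one_mul]⟩
    · exact ⟨-1, Or.inr rfl, fun p hp => by rw [abs_of_nonpos (hs p hp), neg_one_mul]⟩
  have ha2 : 0 < a ^ 2 := by positivity
  have hGpos : 0 < a ^ 2 / 2 - 2 * b ^ 2 / a ^ 2 := by linarith [sq_nonneg b]
  suffices w (i + 2) ≤ W / (a ^ 2 / 2 - 2 * b ^ 2 / a ^ 2) by
    rw [le_div_iff₀ hGpos] at this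
    linarith
  refine hge _ _ (div_nonneg hW0 hGpos.le) ?_
  intro p hp q hq
  rw [le_div_iff₀ hGpos]
  -- with the expansion factors `α` to the right and `β` to the left of the fold, the width is at
  -- most `W / α + W / β`; the worst case is `α = a ^ 2 + 2 * b`, `β = a ^ 2 - 2 * b`
  have e : (u (i + 2) p - u (i + 2) q) * (a ^ 2 / 2 - 2 * b ^ 2 / a ^ 2) =
      (u (i + 2) p - u (i + 2) q) * ((a ^ 2 + 2 * b) * (a ^ 2 - 2 * b)) / (2 * a ^ 2) := by
    field_simp
    ring
  rw [e, div_le_iff₀ (by positivity)]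
  obtain ⟨s, hs1, hdisp⟩ := hdisp
  have h1 := hdisp p hp
  have h2 := hdisp q hq
  have h3 := mul_le_mul_of_nonneg_left (le_abs_self (u (i + 2) p)) ha2.le
  have h4 := mul_le_mul_of_nonneg_left (neg_le_abs (u (i + 2) q)) ha2.le
  have hβ : 0 < a ^ 2 - 2 * b := by linarith
  rcases hs1 with rfl | rfl
  · have k1 : (a ^ 2 + 2 * b) * u (i + 2) p ≤ W := by linarith
    have k2 : (a ^ 2 - 2 * b) * (-u (i + 2) q) ≤ W := by linarith
    nlinarith [mul_le_mul_of_nonneg_left k1 hβ.le,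
      mul_le_mul_of_nonneg_left k2 (by positivity : 0 ≤ a ^ 2 + 2 * b)]
  · have k1 : a ^ 2 * (u (i + 2) p - u (i + 2) q) ≤ 2 * W := by linarith
    have k2 : (a ^ 2 + 2 * b) * (a ^ 2 - 2 * b) ≤ a ^ 2 * a ^ 2 := by nlinarith [sq_nonneg b]
    rcases le_total (u (i + 2) p - u (i + 2) q) 0 with k3 | k3
    · exact (mul_nonpos_of_nonpos_of_nonneg k3 (by positivity)).trans (by positivity)
    · calc (u (i + 2) p - u (i + 2) q) * ((a ^ 2 + 2 * b) * (a ^ 2 - 2 * b))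
          ≤ (u (i + 2) p - u (i + 2) q) * (a ^ 2 * a ^ 2) := mul_le_mul_of_nonneg_left k2 k3
        _ = a ^ 2 * (a ^ 2 * (u (i + 2) p - u (i + 2) q)) := by ring
        _ ≤ a ^ 2 * (2 * W) := mul_le_mul_of_nonneg_left k1 ha2.le
        _ = W * (2 * a ^ 2) := by ring

/-- A set is one-sided if none of its forward images has points strictly on both sides of the
stable line. -/
def OneSided (a b ν : ℝ) (K : Set (ℝ × ℝ)) : Prop :=
  ∀ i, ∀ p ∈ K, ∀ q ∈ K, loziLine ν ((loziMap a b)^[i] p) < 0 →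
    ¬ 0 < loziLine ν ((loziMap a b)^[i] q)

/-- The constant `C` in the bound `C * (9 / 10) ^ i` for the diameter of the `i`-th image of a
connected one-sided set. -/
noncomputable def contractionConst (a b : ℝ) : ℝ := 2 * Metric.diam (loziTriangle a b)

namespace LoziParams

variable {a b ν : ℝ} (h : LoziParams a b ν)
include h

/-- Connected one-sided sets are contracted uniformly. The first coordinates along an orbit satisfy
the Lozi recursion, and if an image of the set meets the fold, then one-sidedness places the next
image entirely in the right half-plane. -/
theorem dist_iterate_le_of_oneSided {K : Set (ℝ × ℝ)} (hK : IsPreconnected K)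
    (hKΔ : K ⊆ loziTriangle a b) (hone : OneSided a b ν K) (i : ℕ) {p q : ℝ × ℝ} (hp : p ∈ K)
    (hq : q ∈ K) : dist ((loziMap a b)^[i] p) ((loziMap a b)^[i] q) ≤
      contractionConst a b * (9 / 10) ^ i := by
  have hb := h.b_pos
  have hb2 := h.b_lt
  have ha := h.a_gt
  have ha2 := h.lt_sq_a
  have ha2pos : 0 < a ^ 2 := pow_pos h.a_pos 2
  set M := Metric.diam (loziTriangle a b) with hMdef
  have hM : 0 ≤ M := Metric.diam_nonneg
  have hdist : ∀ i, ∀ p ∈ K, ∀ q ∈ K, dist ((loziMap a b)^[i] p) ((loziMap a b)^[i] q) ≤ M :=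
    fun i p hp q hq => Metric.dist_le_diam_of_mem (isCompact_loziTriangle a b).isBounded
      (h.iterate_mem (hKΔ hp) i) (h.iterate_mem (hKΔ hq) i)
  have key : ∀ i, ∀ p ∈ K, ∀ q ∈ K, |((loziMap a b)^[i] p).1 - ((loziMap a b)^[i] q).1| ≤
      10 / 9 * M * (9 / 10) ^ i := by
    intro i p hp q hq
    refine geometric_decay_of_loziRecursion hK (u := fun i p => ((loziMap a b)^[i] p).1)
      (fun i => (continuous_fst.comp ((continuous_loziMap a b).iterate i)).continuousOn)
      h.a_pos hb.le (by linarith) (by nlinarith) ?_ hM ?_ ?_ ?_ i hp hq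
    · have : 2 * b ^ 2 / a ^ 2 ≤ b ^ 2 := by
        rw [div_le_iff₀ ha2pos]
        nlinarith [sq_nonneg b]
      nlinarith
    · intro i p _
      simp only [Function.iterate_succ_apply', loziMap]
    · intro i c hc hc0 p hp
      have h1 := h.loziLine_loziMap_pos (h.iterate_mem (hKΔ hc) i) hc0
      rw [← Function.iterate_succ_apply' (loziMap a b)] at h1
      exact h.fst_pos (h.iterate_mem (hKΔ hp) _)
        (not_lt.1 fun hlt => hone (i + 1) p hp c hc hlt h1)
    · exact fun i p hp q hq => (le_max_left _ _).trans (hdist i p hp q hq)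
  have hC : 10 / 9 * M * (9 / 10) ^ i ≤ 2 * M * (9 / 10) ^ i :=
    mul_le_mul_of_nonneg_right (by linarith) (by positivity)
  rw [contractionConst, Prod.dist_eq, max_le_iff]
  refine ⟨(key i p hp q hq).trans hC, ?_⟩
  cases i with
  | zero =>
    refine ((le_max_right _ _).trans (hdist 0 p hp q hq)).trans ?_
    rw [pow_zero, mul_one]
    linarith
  | succ i =>
    have h1 := key i p hp q hq
    rw [Function.iterate_succ_apply', Function.iterate_succ_apply']
    simp only [loziMap]
    rw [Real.dist_eq, ← mul_sub, abs_mul, abs_of_pos hb, pow_succ]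
    have hp : 0 ≤ M * (9 / 10 : ℝ) ^ i := by positivity
    nlinarith [abs_nonneg (((loziMap a b)^[i] p).1 - ((loziMap a b)^[i] q).1)]

end LoziParams

/-! ### The family of stable leaves in the triangle -/

/-- The components of the pieces `stablePiece a b ν n`, as subsets of the triangle. -/
def stableLeaves (a b ν : ℝ) : Set (Set (loziTriangle a b)) :=
  {γ | ∃ n, ∃ p ∈ (Subtype.val ⁻¹' stablePiece a b ν n : Set (loziTriangle a b)),
    γ = connectedComponentIn (Subtype.val ⁻¹' stablePiece a b ν n) p}

theorem isClosed_connectedComponentIn {X : Type*} [TopologicalSpace X] {F : Set X}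
    (hF : IsClosed F) (x : X) : IsClosed (connectedComponentIn F x) := by
  by_cases hx : x ∈ F
  · refine closure_subset_iff_isClosed.1 ?_
    exact isPreconnected_connectedComponentIn.closure.subset_connectedComponentIn
      (subset_closure (mem_connectedComponentIn hx))
      (closure_minimal (connectedComponentIn_subset F x) hF)
  · rw [connectedComponentIn_eq_empty hx]
    exact isClosed_empty

theorem isClosed_preimage_stablePiece (a b ν : ℝ) (n : ℕ) :
    IsClosed (Subtype.val ⁻¹' stablePiece a b ν n : Set (loziTriangle a b)) :=
  (isClosed_stablePiece a b ν n).preimage continuous_subtype_val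

instance compactSpace_loziTriangle (a b : ℝ) : CompactSpace (loziTriangle a b) :=
  isCompact_iff_compactSpace.1 (isCompact_loziTriangle a b)

theorem loziTriangle_nonempty (a b : ℝ) : (loziTriangle a b).Nonempty :=
  ⟨loziZ a b, subset_convexHull ℝ _ (mem_insert _ _)⟩

instance pathConnectedSpace_loziTriangle (a b : ℝ) : PathConnectedSpace (loziTriangle a b) :=
  isPathConnected_iff_pathConnectedSpace.1
    ((convex_loziTriangle a b).isPathConnected (loziTriangle_nonempty a b))

instance locallyPathConnectedSpace_loziTriangle (a b : ℝ) :
    LocallyPathConnectedSpace (loziTriangle a b) :=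
  (convex_loziTriangle a b).locallyPathConnectedSpace

theorem unicoherent_loziTriangle (a b : ℝ) : Unicoherent (loziTriangle a b) := by
  have := (convex_loziTriangle a b).contractibleSpace (loziTriangle_nonempty a b)
  exact unicoherent_of_simplyConnected _

theorem mem_stablePiece_of_mem_leaf {a b ν : ℝ} {n : ℕ} {p q : loziTriangle a b}
    (h : p ∈ connectedComponentIn (Subtype.val ⁻¹' stablePiece a b ν n) q) :
    (p : ℝ × ℝ) ∈ stablePiece a b ν n :=
  connectedComponentIn_subset (Subtype.val ⁻¹' stablePiece a b ν n) q h

/-- Points strictly on different sides of the stable line are separated by a leaf. -/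
theorem not_notSeparated_of_loziLine {a b ν : ℝ} {p q : loziTriangle a b} (hp : loziLine ν p < 0)
    (hq : 0 < loziLine ν q) : ¬ NotSeparated (stableLeaves a b ν) p q := by
  intro hpq
  have hc : Continuous fun x : loziTriangle a b => loziLine ν x :=
    (continuous_loziLine ν).comp continuous_subtype_val
  have hS : Separates (Subtype.val ⁻¹' stablePiece a b ν 0 : Set (loziTriangle a b)) p q := by
    refine separates_of_isOpen (isOpen_lt hc continuous_const) (isOpen_lt continuous_const hc)
      ?_ ?_ hp ?_ hq ?_
    · exact disjoint_left.2 fun x hx hx' => lt_asymm (α := ℝ) hx hx'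
    · intro x hx
      exact lt_or_gt_of_ne fun h0 => hx ⟨x.2, h0⟩
    · exact fun h0 => hp.ne h0.2
    · exact fun h0 => hq.ne' h0.2
  obtain ⟨M, hMS, hM, hMc, ⟨x, hx⟩, hMsep⟩ := hS.exists_isPreconnected
    (unicoherent_loziTriangle a b) (isClosed_preimage_stablePiece a b ν 0)
  refine hpq _ ⟨0, x, hMS hx, rfl⟩ (hMsep.mono (hMc.subset_connectedComponentIn hx hMS) ?_ ?_)
  · exact fun h0 => hS.1 (connectedComponentIn_subset _ _ h0)
  · exact fun h0 => hS.2.1 (connectedComponentIn_subset _ _ h0)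

theorem tendsto_contractionConst (a b : ℝ) :
    Tendsto (fun i : ℕ => contractionConst a b * (9 / 10 : ℝ) ^ i) atTop (𝓝 0) := by
  rw [← mul_zero (contractionConst a b)]
  exact (tendsto_pow_atTop_nhds_zero_of_lt_one (by norm_num) (by norm_num)).const_mul _

namespace LoziParams

variable {a b ν : ℝ} (h : LoziParams a b ν)
include h

/-- The restriction of the Lozi map to the triangle. -/
def restrictMap : loziTriangle a b → loziTriangle a b :=
  h.mapsTo_loziMap.restrict (loziMap a b) _ _

theorem coe_restrictMap (p : loziTriangle a b) :
    (h.restrictMap p : ℝ × ℝ) = loziMap a b p := rfl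

theorem continuous_restrictMap : Continuous h.restrictMap :=
  (continuous_loziMap a b).restrict h.mapsTo_loziMap

theorem coe_iterate_restrictMap (n : ℕ) (p : loziTriangle a b) :
    ((h.restrictMap^[n] p : loziTriangle a b) : ℝ × ℝ) = (loziMap a b)^[n] p := by
  induction n with
  | zero => rfl
  | succ n ih =>
    rw [Function.iterate_succ_apply', Function.iterate_succ_apply', coe_restrictMap, ih]

theorem eq_of_mem_stablePiece {m n : ℕ} {p : ℝ × ℝ} (hm : p ∈ stablePiece a b ν m)
    (hn : p ∈ stablePiece a b ν n) : m = n := by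
  by_contra hne
  exact disjoint_left.1 (h.disjoint_stablePiece hne) hm hn

theorem disjointContinua_stableLeaves : DisjointContinua (stableLeaves a b ν) where
  isClosed := by
    rintro _ ⟨n, p, -, rfl⟩
    exact isClosed_connectedComponentIn (isClosed_preimage_stablePiece a b ν n) p
  isPreconnected := by
    rintro _ ⟨n, p, -, rfl⟩
    exact isPreconnected_connectedComponentIn
  nonempty := by
    rintro _ ⟨n, p, hp, rfl⟩
    exact ⟨p, mem_connectedComponentIn hp⟩
  disjoint := by
    rintro _ ⟨n, p, hp, rfl⟩ _ ⟨m, q, hq, rfl⟩ hne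
    rw [disjoint_left]
    intro x hx hx'
    obtain rfl := h.eq_of_mem_stablePiece (mem_stablePiece_of_mem_leaf hx)
      (mem_stablePiece_of_mem_leaf hx')
    exact hne ((connectedComponentIn_eq hx).trans (connectedComponentIn_eq hx').symm)

theorem mem_loziStable_of_mem_leaf {γ : Set (loziTriangle a b)} (hγ : γ ∈ stableLeaves a b ν)
    {p : loziTriangle a b} (hp : p ∈ γ) : (p : ℝ × ℝ) ∈ loziStable a b := by
  obtain ⟨n, q, -, rfl⟩ := hγ
  have h1 : (p : ℝ × ℝ) ∈ ⋃ n, stablePiece a b ν n :=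
    mem_iUnion.2 ⟨n, mem_stablePiece_of_mem_leaf hp⟩
  rw [h.iUnion_stablePiece] at h1
  exact h1.2

theorem exists_mem_stablePiece {p : loziTriangle a b} (hp : (p : ℝ × ℝ) ∈ loziStable a b) :
    ∃ n, (p : ℝ × ℝ) ∈ stablePiece a b ν n := by
  rw [← mem_iUnion, h.iUnion_stablePiece]
  exact ⟨p.2, hp⟩

/-- A closed connected set of points of the stable manifold lies in a single leaf. -/
theorem exists_leaf_of_isPreconnected {M : Set (loziTriangle a b)} (hM : IsClosed M)
    (hMc : IsPreconnected M) (hMs : ∀ p ∈ M, (p : ℝ × ℝ) ∈ loziStable a b) {x : loziTriangle a b}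
    (hx : x ∈ M) : ∃ n, (x : ℝ × ℝ) ∈ stablePiece a b ν n ∧
      M ⊆ connectedComponentIn (Subtype.val ⁻¹' stablePiece a b ν n) x := by
  obtain ⟨n, hn⟩ := exists_subset_of_isPreconnected_of_subset_iUnion
    (isClosed_preimage_stablePiece a b ν)
    (fun m n hmn => (h.disjoint_stablePiece hmn).preimage _) hM.isCompact hMc
    (fun p hp => mem_iUnion.2 (h.exists_mem_stablePiece (hMs p hp)))
  exact ⟨n, hn hx, hMc.subset_connectedComponentIn hx hn⟩

theorem loziMap_mem_stablePiece {n : ℕ} {p : ℝ × ℝ} (hp : p ∈ stablePiece a b ν n) :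
    loziMap a b p ∈ stablePiece a b ν (n - 1) := by
  have hpΔ := stablePiece_subset _ _ _ _ hp
  have hL := h.mapsTo_loziMap hpΔ
  match n, hp with
  | 0, hp => exact ⟨hL, h.loziLine_iterate_eq_zero hpΔ (Nat.zero_le 1) hp.2⟩
  | 1, hp => exact ⟨hL, hp.2.1⟩
  | n + 2, hp => exact ⟨hL, hp.2⟩

/-- If a leaf separates the images of two points, some leaf separates the points: the preimage of
the leaf contains a continuum separating them, and this continuum lies in a leaf. -/
theorem notSeparated_restrictMap {p q : loziTriangle a b}
    (hpq : NotSeparated (stableLeaves a b ν) p q) :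
    NotSeparated (stableLeaves a b ν) (h.restrictMap p) (h.restrictMap q) := by
  intro γ hγ hs
  have hcl := (h.disjointContinua_stableLeaves.isClosed γ hγ).preimage h.continuous_restrictMap
  have hS : Separates (h.restrictMap ⁻¹' γ) p q := by
    refine ⟨hs.1, hs.2.1, fun hc => ?_⟩
    obtain ⟨s, hs1, hs2, hs3, hs4⟩ := mem_connectedComponentIn_iff.1 hc
    refine not_separates_of_isPreconnected (hs2.image _ h.continuous_restrictMap.continuousOn) ?_
      (mem_image_of_mem _ hs3) (mem_image_of_mem _ hs4) hs
    rw [disjoint_left]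
    rintro _ ⟨x, hx, rfl⟩ hxγ
    exact hs1 hx hxγ
  obtain ⟨M, hMS, hM, hMc, ⟨x, hx⟩, hMsep⟩ := hS.exists_isPreconnected
    (unicoherent_loziTriangle a b) hcl
  obtain ⟨n, hxn, hMn⟩ := h.exists_leaf_of_isPreconnected hM hMc (fun p hp =>
    (iterate_mem_loziStable 1).1 (h.mem_loziStable_of_mem_leaf hγ (hMS hp))) hx
  refine hpq _ ⟨n, x, hxn, rfl⟩ ?_
  suffices hsub : connectedComponentIn (Subtype.val ⁻¹' stablePiece a b ν n) x ⊆
      h.restrictMap ⁻¹' γ from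
    hMsep.mono hMn (fun hp => hs.1 (hsub hp)) (fun hq => hs.2.1 (hsub hq))
  obtain ⟨m, y, hy, rfl⟩ := hγ
  have hxm : loziMap a b x ∈ stablePiece a b ν m := mem_stablePiece_of_mem_leaf (hMS hx)
  obtain rfl := h.eq_of_mem_stablePiece hxm (h.loziMap_mem_stablePiece hxn)
  rw [← image_subset_iff, connectedComponentIn_eq (hMS hx)]
  refine (isPreconnected_connectedComponentIn.image _
    h.continuous_restrictMap.continuousOn).subset_connectedComponentIn
    (mem_image_of_mem _ (mem_connectedComponentIn hxn)) ?_
  rintro _ ⟨z, hz, rfl⟩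
  exact h.loziMap_mem_stablePiece (mem_stablePiece_of_mem_leaf hz)

theorem notSeparated_iterate {p q : loziTriangle a b}
    (hpq : NotSeparated (stableLeaves a b ν) p q) (n : ℕ) :
    NotSeparated (stableLeaves a b ν) (h.restrictMap^[n] p) (h.restrictMap^[n] q) := by
  induction n with
  | zero => exact hpq
  | succ n ih =>
    rw [Function.iterate_succ_apply', Function.iterate_succ_apply']
    exact h.notSeparated_restrictMap ih

theorem oneSided_of_notSeparated {K : Set (loziTriangle a b)}
    (hK : ∀ p ∈ K, ∀ q ∈ K, NotSeparated (stableLeaves a b ν) p q) :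
    OneSided a b ν (Subtype.val '' K) := by
  rintro i _ ⟨p, hp, rfl⟩ _ ⟨q, hq, rfl⟩ h1 h2
  rw [← h.coe_iterate_restrictMap] at h1 h2
  exact not_notSeparated_of_loziLine h1 h2 (h.notSeparated_iterate (hK p hp q hq) i)

theorem dist_iterate_le_of_notSeparated {q : loziTriangle a b}
    (hone : OneSided a b ν (Subtype.val '' {p | NotSeparated (stableLeaves a b ν) p q}))
    {p : loziTriangle a b} (hp : NotSeparated (stableLeaves a b ν) p q) (i : ℕ) :
    dist ((loziMap a b)^[i] p) ((loziMap a b)^[i] q) ≤ contractionConst a b * (9 / 10) ^ i := by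
  refine h.dist_iterate_le_of_oneSided ?_ ?_ hone i (mem_image_of_mem _ hp)
    (mem_image_of_mem _ (NotSeparated.refl _ q))
  · exact (h.disjointContinua_stableLeaves.isPreconnected_setOf_notSeparated
      (unicoherent_loziTriangle a b) q).image _ continuous_subtype_val.continuousOn
  · rintro _ ⟨p, -, rfl⟩
    exact p.2

/-- A point `q` outside the stable manifold is separated by a leaf from every point `p` on it. The
orbit of `q` never meets the stable line, so no image of the class of `q` crosses that line; hence
the class is contracted, and if it contained `p`, the orbit of `q` would converge to `X`. -/
theorem mem_loziStable_of_notSeparated {p q : loziTriangle a b}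
    (hp : (p : ℝ × ℝ) ∈ loziStable a b) (hpq : NotSeparated (stableLeaves a b ν) p q) :
    (q : ℝ × ℝ) ∈ loziStable a b := by
  by_contra hq
  have hqi : ∀ i, loziLine ν ((loziMap a b)^[i] q) ≠ 0 := fun i h0 =>
    hq ((iterate_mem_loziStable i).1
      (h.mem_loziStable_of_loziLine (h.iterate_mem q.2 i) h0))
  have hone : OneSided a b ν (Subtype.val '' {p | NotSeparated (stableLeaves a b ν) p q}) := by
    rintro i _ ⟨x, hx, rfl⟩ _ ⟨y, hy, rfl⟩ h1 h2
    have hx' := h.notSeparated_iterate hx i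
    have hy' := h.notSeparated_iterate hy i
    have hq' := hqi i
    rw [← h.coe_iterate_restrictMap] at h1 h2 hq'
    rcases lt_or_gt_of_ne hq' with h0 | h0
    · exact not_notSeparated_of_loziLine h0 h2 hy'.symm
    · exact not_notSeparated_of_loziLine h1 h0 hx'
  have hlim : Tendsto (fun n : ℕ => (loziMap a b)^[n] (p : ℝ × ℝ)) atTop (𝓝 (loziX a b)) := hp
  refine hq (hlim.congr_dist ?_)
  exact squeeze_zero (fun _ => dist_nonneg)
    (fun i => h.dist_iterate_le_of_notSeparated hone hpq i) (tendsto_contractionConst a b)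

/-- The class of a point of the stable manifold is contained in its leaf. -/
theorem mem_leaf_of_notSeparated {p q : loziTriangle a b} {n : ℕ}
    (hq : (q : ℝ × ℝ) ∈ stablePiece a b ν n) (hpq : NotSeparated (stableLeaves a b ν) p q) :
    p ∈ connectedComponentIn (Subtype.val ⁻¹' stablePiece a b ν n : Set (loziTriangle a b)) q := by
  have hqs : (q : ℝ × ℝ) ∈ loziStable a b :=
    (h.iUnion_stablePiece.subset (mem_iUnion.2 ⟨n, hq⟩)).2
  obtain ⟨m, hm, hsub⟩ := h.exists_leaf_of_isPreconnected
    (isClosed_setOf_notSeparated h.disjointContinua_stableLeaves.isClosed q)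
    (h.disjointContinua_stableLeaves.isPreconnected_setOf_notSeparated
      (unicoherent_loziTriangle a b) q)
    (fun p hp => h.mem_loziStable_of_notSeparated hqs (NotSeparated.symm hp))
    (NotSeparated.refl _ q)
  obtain rfl := h.eq_of_mem_stablePiece hm hq
  exact hsub hpq

theorem not_notSeparated_of_mem_leaf : ∀ γ ∈ stableLeaves a b ν, ∀ q ∈ γ, ∀ p ∉ γ,
    ¬ NotSeparated (stableLeaves a b ν) p q := by
  rintro _ ⟨n, x, -, rfl⟩ q hq p hp hpq
  rw [connectedComponentIn_eq hq] at hp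
  exact hp (h.mem_leaf_of_notSeparated (mem_stablePiece_of_mem_leaf hq) hpq)

/-- The map contracts the classes of points not separated by a leaf, uniformly in the class. -/
theorem dist_iterate_le {p q : loziTriangle a b}
    (hpq : NotSeparated (stableLeaves a b ν) p q) (i : ℕ) :
    dist ((loziMap a b)^[i] p) ((loziMap a b)^[i] q) ≤ contractionConst a b * (9 / 10) ^ i :=
  h.dist_iterate_le_of_notSeparated (h.oneSided_of_notSeparated fun _ hx _ hy =>
    NotSeparated.trans h.not_notSeparated_of_mem_leaf hx (NotSeparated.symm hy)) hpq i

theorem exists_not_notSeparated : ∃ p q, ¬ NotSeparated (stableLeaves a b ν) p q := by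
  have h1 := h.D_pos
  have h2 := h.ν_pos
  have h3 : 0 < ν - 1 := by linarith [h.ν_gt, h.b_pos]
  have h5 := h.b_pos
  refine ⟨⟨loziMap a b (loziZ a b), subset_convexHull ℝ _ (by simp)⟩,
    ⟨loziZ a b, subset_convexHull ℝ _ (by simp)⟩, not_notSeparated_of_loziLine ?_ ?_⟩
  · simp only [h.loziZ_eq, h.loziMap_Z, loziLine]
    have : 0 < ν * (ν * (ν - 1) / (ν - b)) + b * ν / (ν - b) + ν / (1 + ν) := by positivity
    rw [neg_mul, neg_div]
    linarith
  · simp only [h.loziZ_eq, loziLine, sub_zero]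
    rw [sub_pos, ← mul_div_assoc, div_lt_div_iff₀ (by linarith) h1]
    nlinarith

end LoziParams

/-! ### The components of the trace of the stable manifold -/

theorem connectedComponentIn_image_val {X : Type*} [TopologicalSpace X] {D : Set X} (F : Set D)
    (p : D) : connectedComponentIn (Subtype.val '' F) (p : X) =
      Subtype.val '' connectedComponentIn F p := by
  ext x
  rw [mem_connectedComponentIn_iff]
  constructor
  · rintro ⟨s, hs, hc, hp, hx⟩
    obtain ⟨y, hy, rfl⟩ := hs hx
    refine mem_image_of_mem _ (mem_connectedComponentIn_iff.2 ⟨Subtype.val ⁻¹' s, ?_, ?_, hp, hx⟩)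
    · intro z hz
      obtain ⟨w, hw, hwz⟩ := hs hz
      rwa [← Subtype.ext hwz]
    · rw [← IsInducing.subtypeVal.isPreconnected_image, image_preimage_eq_of_subset]
      · exact hc
      · exact fun z hz => let ⟨w, _, hwz⟩ := hs hz; ⟨w, hwz⟩
  · rintro ⟨y, hy, rfl⟩
    obtain ⟨s, hs, hc, hp, hx⟩ := mem_connectedComponentIn_iff.1 hy
    exact ⟨_, image_mono hs, hc.image _ continuous_subtype_val.continuousOn,
      mem_image_of_mem _ hp, mem_image_of_mem _ hx⟩

theorem separatesIn_image_val_iff {D : Set (ℝ × ℝ)} (γ : Set D) (p q : D) :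
    SeparatesIn D (Subtype.val '' γ) p q ↔ Separates γ p q := by
  have h1 : D \ Subtype.val '' γ = Subtype.val '' γᶜ := by
    rw [image_compl_eq_range_sdiff_image Subtype.val_injective, Subtype.range_coe]
  have h2 : ∀ (F : Set D) (x : D), (x : ℝ × ℝ) ∈ Subtype.val '' F ↔ x ∈ F := fun F x =>
    Subtype.val_injective.mem_set_image
  rw [SeparatesIn, Separates, h1, connectedComponentIn_image_val, h2, h2, h2]
  rfl

namespace LoziParams

variable {a b ν : ℝ} (h : LoziParams a b ν)
include h

/-- The image of the stable manifold in a quotient of the triangle by the relation of not being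
separated by a leaf is countable: it is covered by the images of countably many convex sets, and
these are points. -/
theorem countable_image_stable {T : Type*} {π : loziTriangle a b → T}
    (hπ : ∀ p q, π p = π q ↔ NotSeparated (stableLeaves a b ν) p q) :
    (π '' {p | (p : ℝ × ℝ) ∈ loziStable a b}).Countable := by
  have hsub : π '' {p | (p : ℝ × ℝ) ∈ loziStable a b} ⊆
      ⋃ n, π '' (Subtype.val ⁻¹' stablePiece a b ν n) := by
    rintro _ ⟨p, hp, rfl⟩
    obtain ⟨n, hn⟩ := h.exists_mem_stablePiece hp
    exact mem_iUnion.2 ⟨n, mem_image_of_mem _ hn⟩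
  refine (countable_iUnion fun n => ?_).mono hsub
  obtain ⟨𝒞, h𝒞, hconv, hD⟩ := isCountableUnionConvex_stablePiece a b ν n
  rw [← hD, sUnion_eq_biUnion, preimage_iUnion₂, image_iUnion₂]
  refine h𝒞.biUnion fun C hC => Set.Subsingleton.countable ?_
  have hCsub : C ⊆ stablePiece a b ν n := hD ▸ subset_sUnion_of_mem hC
  have hpre : IsPreconnected (Subtype.val ⁻¹' C : Set (loziTriangle a b)) := by
    rw [← IsInducing.subtypeVal.isPreconnected_image, image_preimage_eq_of_subset]
    · exact (hconv C hC).isPreconnected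
    · rw [Subtype.range_coe]
      exact hCsub.trans (stablePiece_subset a b ν n)
  rintro _ ⟨p, hp, rfl⟩ _ ⟨q, hq, rfl⟩
  rw [hπ]
  exact h.disjointContinua_stableLeaves.notSeparated_of_mem ⟨n, p, hCsub hp, rfl⟩
    (mem_connectedComponentIn (hCsub hp))
    (hpre.subset_connectedComponentIn hp (preimage_mono hCsub) hq)

/-- The component of a point in the trace of the stable manifold is its leaf. -/
theorem connectedComponentIn_stable {T : Type*} [MetricSpace T] {π : loziTriangle a b → T}
    (hc : Continuous π) (hπ : ∀ p q, π p = π q ↔ NotSeparated (stableLeaves a b ν) p q) {n : ℕ}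
    {p : loziTriangle a b} (hp : (p : ℝ × ℝ) ∈ stablePiece a b ν n) :
    connectedComponentIn (loziTriangle a b ∩ loziStable a b) (p : ℝ × ℝ) =
      Subtype.val '' connectedComponentIn (Subtype.val ⁻¹' stablePiece a b ν n) p := by
  have e : loziTriangle a b ∩ loziStable a b =
      Subtype.val '' (Subtype.val ⁻¹' loziStable a b : Set (loziTriangle a b)) := by
    rw [Subtype.image_preimage_coe]
  rw [e, connectedComponentIn_image_val]
  congr 1
  have hsub : (Subtype.val ⁻¹' stablePiece a b ν n : Set (loziTriangle a b)) ⊆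
      Subtype.val ⁻¹' loziStable a b := fun q hq =>
    (h.iUnion_stablePiece.subset (mem_iUnion.2 ⟨n, hq⟩)).2
  refine Subset.antisymm (fun q hq => ?_) (connectedComponentIn_mono p hsub)
  refine h.mem_leaf_of_notSeparated hp ((hπ q p).1 ?_)
  refine (h.countable_image_stable hπ).isTotallyDisconnected _
    (image_mono (connectedComponentIn_subset (Subtype.val ⁻¹' loziStable a b) p))
    (isPreconnected_connectedComponentIn.image _ hc.continuousOn) (mem_image_of_mem _ hq)
    (mem_image_of_mem _ (mem_connectedComponentIn (hsub hp)))

theorem loziGamma_eq {T : Type*} [MetricSpace T] {π : loziTriangle a b → T}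
    (hc : Continuous π) (hπ : ∀ p q, π p = π q ↔ NotSeparated (stableLeaves a b ν) p q) :
    loziGamma a b = (fun γ => Subtype.val '' γ) '' stableLeaves a b ν := by
  ext γ
  constructor
  · rintro ⟨p, ⟨hpΔ, hps⟩, rfl⟩
    obtain ⟨n, hn⟩ := h.exists_mem_stablePiece (p := ⟨p, hpΔ⟩) hps
    exact ⟨_, ⟨n, ⟨p, hpΔ⟩, hn, rfl⟩, (h.connectedComponentIn_stable hc hπ hn).symm⟩
  · rintro ⟨_, ⟨n, p, hp, rfl⟩, rfl⟩
    exact ⟨p, h.iUnion_stablePiece.subset (mem_iUnion.2 ⟨n, hp⟩),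
      (h.connectedComponentIn_stable hc hπ hp).symm⟩

theorem notSeparated_iff {T : Type*} [MetricSpace T] {π : loziTriangle a b → T}
    (hc : Continuous π) (hπ : ∀ p q, π p = π q ↔ NotSeparated (stableLeaves a b ν) p q)
    (p q : loziTriangle a b) : NotSeparated (stableLeaves a b ν) p q ↔
      ∀ γ ∈ loziGamma a b, ¬ SeparatesIn (loziTriangle a b) γ p q := by
  rw [h.loziGamma_eq hc hπ, forall_mem_image]
  simp only [separatesIn_image_val_iff, NotSeparated]

end LoziParams

/-! ### The attractor as an inverse limit -/

/-- The Lozi map as a homeomorphism of the plane. -/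
noncomputable def loziHomeomorph (a : ℝ) {b : ℝ} (hb : 0 < b) : ℝ × ℝ ≃ₜ ℝ × ℝ where
  toFun := loziMap a b
  invFun p := (p.2 / b, p.1 - 1 + a * |p.2 / b|)
  left_inv p := by
    ext
    · simp only [loziMap]
      field_simp
    · simp only [loziMap, mul_div_cancel_left₀ _ hb.ne']
      ring
  right_inv p := by
    ext
    · simp only [loziMap]
      ring
    · simp only [loziMap]
      field_simp
  continuous_toFun := continuous_loziMap a b
  continuous_invFun := by fun_prop

theorem iterate_loziHomeomorph_symm (a : ℝ) {b : ℝ} (hb : 0 < b) (n : ℕ) (p : ℝ × ℝ) :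
    (loziMap a b)^[n] ((loziHomeomorph a hb).symm^[n] p) = p :=
  Function.LeftInverse.iterate (g := loziMap a b) (loziHomeomorph a hb).apply_symm_apply n p

theorem loziHomeomorph_symm_iterate (a : ℝ) {b : ℝ} (hb : 0 < b) (n : ℕ) (p : ℝ × ℝ) :
    (loziHomeomorph a hb).symm^[n] ((loziMap a b)^[n] p) = p :=
  Function.LeftInverse.iterate (f := loziMap a b) (loziHomeomorph a hb).symm_apply_apply n p

theorem loziAttractor_subset (a b : ℝ) : loziAttractor a b ⊆ loziTriangle a b := fun p hp => by
  simpa using mem_iInter.1 hp 0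

theorem isCompact_loziAttractor (a b : ℝ) : IsCompact (loziAttractor a b) := by
  refine (isCompact_loziTriangle a b).of_isClosed_subset (isClosed_iInter fun n => ?_)
    (loziAttractor_subset a b)
  exact ((isCompact_loziTriangle a b).image ((continuous_loziMap a b).iterate n)).isClosed

instance compactSpace_loziAttractor (a b : ℝ) : CompactSpace (loziAttractor a b) :=
  isCompact_iff_compactSpace.1 (isCompact_loziAttractor a b)

theorem iterate_symm_mem_loziTriangle (a : ℝ) {b : ℝ} (hb : 0 < b) {p : ℝ × ℝ}
    (hp : p ∈ loziAttractor a b) (n : ℕ) :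
    (loziHomeomorph a hb).symm^[n] p ∈ loziTriangle a b := by
  obtain ⟨q, hq, rfl⟩ := mem_iInter.1 hp n
  rwa [loziHomeomorph_symm_iterate]

theorem mapsTo_loziAttractor {a b : ℝ}
    (hΔ : MapsTo (loziMap a b) (loziTriangle a b) (loziTriangle a b)) :
    MapsTo (loziMap a b) (loziAttractor a b) (loziAttractor a b) := by
  intro p hp
  refine mem_iInter.2 fun n => ?_
  obtain ⟨q, hq, rfl⟩ := mem_iInter.1 hp n
  exact ⟨loziMap a b q, hΔ hq, by rw [← Function.iterate_succ_apply, Function.iterate_succ_apply']⟩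

namespace LoziParams

variable {a b ν : ℝ} (h : LoziParams a b ν)
include h

/-- The attractor is conjugate to the inverse limit of any factor map on a Hausdorff quotient by
the relation of not being separated by a leaf: a point is determined by the classes of its backward
orbit because the classes are contracted by the map. -/
theorem exists_homeomorph_inverseLimit {T : Type*} [MetricSpace T] {f : T → T} (hf : Continuous f)
    {π : loziTriangle a b → T} (hc : Continuous π) (hs : Function.Surjective π)
    (hπ : ∀ p q, π p = π q ↔ NotSeparated (stableLeaves a b ν) p q)
    (hfπ : Function.Semiconj π h.restrictMap f) :
    ∃ Φ : loziAttractor a b ≃ₜ InverseLimit f,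
      Function.Semiconj Φ ((mapsTo_loziAttractor h.mapsTo_loziMap).restrict (loziMap a b) _ _)
        (shiftHomeomorph f hf) := by
  have hb := h.b_pos
  set H := loziHomeomorph a hb with hH
  let back : ℕ → loziAttractor a b → loziTriangle a b := fun n p =>
    ⟨H.symm^[n] p, iterate_symm_mem_loziTriangle a hb p.2 n⟩
  have hback : ∀ n p, h.restrictMap (back (n + 1) p) = back n p := by
    intro n p
    ext1
    simp only [back, coe_restrictMap, Function.iterate_succ_apply']
    exact H.apply_symm_apply _
  have hbackc : ∀ n, Continuous (back n) := fun n =>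
    ((H.symm.continuous.iterate n).comp continuous_subtype_val).subtype_mk _
  let Φ : loziAttractor a b → InverseLimit f := fun p =>
    ⟨fun n => π (back n p), fun n => by rw [← hfπ.eq, hback]⟩
  have hΦc : Continuous Φ :=
    (continuous_pi fun n => hc.comp (hbackc n)).subtype_mk _
  have hΦinj : Function.Injective Φ := by
    intro p q hpq
    have hns : ∀ n, NotSeparated (stableLeaves a b ν) (back n p) (back n q) := fun n =>
      (hπ _ _).1 (congrFun (congrArg Subtype.val hpq) n)
    have hd : ∀ n : ℕ, dist (p : ℝ × ℝ) q ≤ contractionConst a b * (9 / 10) ^ n := by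
      intro n
      have := h.dist_iterate_le (hns n) n
      simp only [back, hH, iterate_loziHomeomorph_symm] at this
      exact this
    exact Subtype.ext (dist_le_zero.1 (ge_of_tendsto' (tendsto_contractionConst a b) hd))
  have hΦsurj : Function.Surjective Φ := by
    intro x
    let A : ℕ → Set (ℝ × ℝ) := fun n => (loziMap a b)^[n] '' (Subtype.val '' (π ⁻¹' {x.1 n}))
    have hAc : ∀ n, IsCompact (A n) := fun n =>
      (((isClosed_singleton.preimage hc).isCompact.image continuous_subtype_val).image
        ((continuous_loziMap a b).iterate n))
    obtain ⟨p, hp⟩ := IsCompact.nonempty_iInter_of_sequence_nonempty_isCompact_isClosed A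
      (by
        rintro n _ ⟨_, ⟨q, hq, rfl⟩, rfl⟩
        refine ⟨h.restrictMap q, mem_image_of_mem _ ?_, ?_⟩
        · rw [mem_preimage, mem_singleton_iff, hfπ.eq, mem_singleton_iff.1 hq, x.2 n]
        · rw [coe_restrictMap, Function.iterate_succ_apply])
      (fun n => by
        obtain ⟨q, hq⟩ := hs (x.1 n)
        exact ⟨_, mem_image_of_mem _ (mem_image_of_mem _ hq)⟩)
      (hAc 0) (fun n => (hAc n).isClosed)
    rw [mem_iInter] at hp
    have hpΛ : p ∈ loziAttractor a b := mem_iInter.2 fun n => by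
      obtain ⟨_, ⟨q, -, rfl⟩, hq⟩ := hp n
      exact ⟨q, q.2, hq⟩
    refine ⟨⟨p, hpΛ⟩, Subtype.ext (funext fun n => ?_)⟩
    obtain ⟨_, ⟨q, hq, rfl⟩, hqp⟩ := hp n
    have : back n ⟨p, hpΛ⟩ = q := by
      ext1
      simp only [back, ← hqp, hH, loziHomeomorph_symm_iterate]
    show π (back n ⟨p, hpΛ⟩) = x.1 n
    rw [this]
    exact hq
  refine ⟨hΦc.homeoOfEquivCompactToT2 (f := Equiv.ofBijective Φ ⟨hΦinj, hΦsurj⟩), fun p => ?_⟩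
  refine Subtype.ext (funext fun n => ?_)
  show π (back n _) = f (π (back n p))
  rw [← hfπ.eq]
  congr 1
  ext1
  simp only [back, coe_restrictMap]
  exact (Function.Commute.iterate_left (f := H.symm) (g := H)
    (fun x => (H.symm_apply_apply x).trans (H.apply_symm_apply x).symm) n).eq p

end LoziParams

theorem theorem1 (a b : ℝ) (hab : (a, b) ∈ misiurewiczSet) :
    ∃ (hΔ : MapsTo (loziMap a b) (loziTriangle a b) (loziTriangle a b))
      (hΛ : MapsTo (loziMap a b) (loziAttractor a b) (loziAttractor a b))
      (T : Type) (_ : MetricSpace T) (f : T → T) (hf : Continuous f)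
      (π : loziTriangle a b → T),
      IsMetricTree T ∧
      Continuous π ∧ Function.Surjective π ∧
      (∀ p q : loziTriangle a b,
        π p = π q ↔ ∀ γ ∈ loziGamma a b, ¬ SeparatesIn (loziTriangle a b) γ p q) ∧
      Function.Semiconj π (hΔ.restrict (loziMap a b) _ _) f ∧
      ∃ Φ : loziAttractor a b ≃ₜ InverseLimit f,
        Function.Semiconj Φ (hΛ.restrict (loziMap a b) _ _) (shiftHomeomorph f hf) := by
  have h := loziParams_of_mem hab
  obtain ⟨T, _, π, hT, hc, hs, hπ⟩ := h.disjointContinua_stableLeaves.exists_isMetricTree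
    h.not_notSeparated_of_mem_leaf h.exists_not_notSeparated
  let f : T → T := fun t => π (h.restrictMap (Function.surjInv hs t))
  have hfπ : Function.Semiconj π h.restrictMap f := fun p =>
    (hπ _ _).2 (h.notSeparated_restrictMap ((hπ _ _).1 (Function.surjInv_eq hs (π p)).symm))
  have hq : IsQuotientMap π := hc.isClosedMap.isQuotientMap hc hs
  have hf : Continuous f := by
    rw [hq.continuous_iff]
    exact (hc.comp h.continuous_restrictMap).congr hfπ.eq
  exact ⟨h.mapsTo_loziMap, mapsTo_loziAttractor h.mapsTo_loziMap, T, _, f, hf, π, hT, hc, hs,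
    fun p q => (hπ p q).trans (h.notSeparated_iff hc hπ p q), hfπ,
    h.exists_homeomorph_inverseLimit hf hc hs hπ hfπ⟩
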